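/- Let $M_G=\langle S_G,A,T_G,R_G,\gamma\rangle$ be a finite Markov decision process with rewards $R_G(s,a)\in[0,1]$ and discount factor $\gamma\in[0,1)$, let $\phi_\eta:S_G\to S_A$ be a surjective aggregation map which is an approximate state abstraction with parameter $\eta>0$ (that is, $\phi_\eta(s_1)=\phi_\eta(s_2)$ implies $|f_\eta(s_1,a)-f_\eta(s_2,a)|\le\eta$ for all $a$, for a given $f_\eta:S_G\times A\to\mathbb R$), let $\omega:S_G\to[0,1]$ be weights with sum $1$ over each fibre of $\phi_\eta$, and let $M_A=\langle S_A,A,T_A,R_A,\gamma\rangle$ be the abstract MDP with $$R_A(\bar s,a)=\sum_{\phi_\eta(u)=\bar s}\omega(u)R_G(u,a),\qquad T_A(\bar s,a,\bar s')=\sum_{\phi_\eta(u)=\bar s}\ \sum_{\phi_\eta(u')=\bar s'}\omega(u)T_G(u,a,u').$$ Write $V_G,V_A$ for the optimal value functions of $M_G,M_A$ and $V_G^\pi,V_A^\pi$ for the values of stationary stochastic policies. Suppose that $\phi_\eta$ has sub-optimality bounded in $\eta$: there is an increasing function $g$ with $g(0)=0$ such that $|V_G(s)-V_A(\phi_\eta(s))|\le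 g(\eta)$ and $|V_G^{\pi\circ\phi_\eta}(s)-V_A^{\pi}(\phi_\eta(s))|\le g(\eta)$ for all $s\in S_G$ and every stochastic policy $\pi$ on $S_A$. Let $\varepsilon=g(\eta)>0$ and $0<\delta<1$. Run MBIE-EB in the abstract MDP $M_A$, from any initial distribution: at time $t$, in the state $\bar s_t$, take the action $\tilde\pi_{A,t}(\bar s_t)$, where $\tilde\pi_{A,t}:S_A\to A$ is greedy (ties being broken by a fixed rule that depends only on the Q-function) for the solution $Q$ of $$Q(\bar s,a)=\hat R_A(\bar s,a)+\gamma\sum_{\bar s'}\hat T_A(\bar s'\mid\bar s,a)\max_{a'}Q(\bar s',a')+\frac{\beta}{\sqrt{N(\bar s,a)}},$$ with $Q(\bar s,a)=1/(1-\gamma)$ if $N(\bar s,a)=0$. Here $N$, $\hat R_A$, $\hat T_A$ are the count and the empirical rewards and transition probabilities over the first $m$ experiences of each state-action pair, and $\beta=\frac1{1-\gamma}\sqrt{\ln(2|S_A||A|m/\delta)/2}$. Let $\tilde\pi_{GA,t}(s)=\tilde\pi_{A,t}(\phi_\eta(s))$. Then, for a suitable positive integer $m$ that depends only on $(|S_A|,|A|,\varepsilon,\delta,\gamma)$,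 with probability at least $1-\delta$ the bound $$V_G(s)-V_G^{\tilde\pi_{GA,t}}(s)\le 3g(\eta)\quad\text{for all } s\in S_G \text{ with } \phi_\eta(s)=\bar s_t$$ holds for all but $T$ time steps $t$, where $$T=\tilde O\!\left(\frac{|S_A|^2|A|}{\varepsilon^3(1-\gamma)^6}\right).$$ Precisely, with $e=\max(1,1/\varepsilon)$ (so $e=1/\varepsilon$ whenever $\varepsilon\le1$), $$T\le C\,\frac{|S_A|^2|A|\,e^3}{(1-\gamma)^6}\,\ln^k\!\Big(2+\frac{|S_A||A|\,e}{(1-\gamma)\delta}\Big),$$ where $C$ and $k$ are absolute constants; in particular the bound does not depend on $|S_G|$. -/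

import Mathlib

noncomputable section

/-- A finite Markov decision process with state space `S`, action space `A`, transition
probabilities `trans s a s'`, rewards in `[0, 1]` and a discount factor in `[0, 1)`. -/
structure FinMDP (S A : Type*) [Fintype S] where
  trans : S → A → S → ℝ
  trans_nonneg : ∀ s a s', 0 ≤ trans s a s'
  trans_sum : ∀ s a, ∑ s', trans s a s' = 1
  reward : S → A → ℝ
  reward_nonneg : ∀ s a, 0 ≤ reward s a
  reward_le_one : ∀ s a, reward s a ≤ 1
  discount : Set.Ico (0 : ℝ) 1

namespace FinMDP

variable {S A : Type*} [Fintype S] [Fintype A]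

/-- The state-to-state transition matrix of the (stochastic) stationary policy `π`, where
`π s a` is the probability of action `a` in state `s`. -/
def policyMatrix (M : FinMDP S A) (π : S → A → ℝ) : Matrix S S ℝ :=
  Matrix.of fun s s' => ∑ a, π s a * M.trans s a s'

/-- The expected one-step reward of `π`. -/
def policyReward (M : FinMDP S A) (π : S → A → ℝ) : S → ℝ :=
  fun s => ∑ a, π s a * M.reward s a

open Classical in
/-- The value `V^π(s)`: the expected discounted sum of the rewards when starting in `s` and
following `π`. The expected reward at time `t` is `(P_π ^ t r_π)(s)`. -/
def value (M : FinMDP S A) (π : S → A → ℝ) (s : S) : ℝ :=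
  ∑' t : ℕ, (M.discount : ℝ) ^ t * ((M.policyMatrix π ^ t).mulVec (M.policyReward π)) s

open Classical in
/-- A deterministic policy, seen as a stochastic one. -/
def det {S A : Type*} (π : S → A) : S → A → ℝ :=
  fun s a => if a = π s then 1 else 0

/-- The optimal value `V^*(s)`: the maximum over the policies `S → A` of their value. -/
def optValue (M : FinMDP S A) (s : S) : ℝ :=
  ⨆ π : S → A, M.value (det π) s

end FinMDP

/-! ### State abstractions -/

section Abstraction

variable {SG SA A : Type*} [Fintype SG] [Fintype SA] [Fintype A]

open Classical in
/-- The set `G(s̄)` of the ground states that are aggregated into `s̄`. -/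
def fiber (φ : SG → SA) (sb : SA) : Finset SG :=
  Finset.univ.filter fun g => φ g = sb

/-- A weighting of the ground states which sums to one over each aggregate. -/
structure IsWeighting (φ : SG → SA) (w : SG → ℝ) : Prop where
  nonneg : ∀ s, 0 ≤ w s
  le_one : ∀ s, w s ≤ 1
  sum_fiber : ∀ s, ∑ g ∈ fiber φ (φ s), w g = 1

/-- `φ` is an approximate state abstraction with parameter `η` for the state-action
function `f`. -/
def IsApproxAbstraction (φ : SG → SA) (f : SG → A → ℝ) (η : ℝ) : Prop :=
  ∀ s₁ s₂, φ s₁ = φ s₂ → ∀ a, |f s₁ a - f s₂ a| ≤ η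

/-- The abstract MDP: rewards and transitions are the convex combinations, with the
weights `w`, of those of the ground states in the aggregate. -/
def abstractMDP (M : FinMDP SG A) (φ : SG → SA) (hφ : Function.Surjective φ)
    (w : SG → ℝ) (hw : IsWeighting φ w) : FinMDP SA A where
  trans sb a sb' := ∑ g ∈ fiber φ sb, ∑ g' ∈ fiber φ sb', w g * M.trans g a g'
  trans_nonneg sb a sb' := Finset.sum_nonneg fun g _ => Finset.sum_nonneg fun g' _ =>
    mul_nonneg (hw.nonneg g) (M.trans_nonneg g a g')
  trans_sum sb a := by
    classical
    obtain ⟨s, rfl⟩ := hφ sb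
    rw [Finset.sum_comm, ← hw.sum_fiber s]
    refine Finset.sum_congr rfl fun g _ => ?_
    have h : ∑ sb', ∑ g' ∈ fiber φ sb', w g * M.trans g a g' = ∑ g', w g * M.trans g a g' := by
      rw [← Finset.sum_fiberwise (s := (Finset.univ : Finset SG)) (g := φ)]
      refine Finset.sum_congr rfl fun sb' _ => Finset.sum_congr ?_ fun _ _ => rfl
      ext g'
      simp [fiber]
    rw [h, ← Finset.mul_sum, M.trans_sum, mul_one]
  reward sb a := ∑ g ∈ fiber φ sb, w g * M.reward g a
  reward_nonneg sb a := Finset.sum_nonneg fun g _ =>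
    mul_nonneg (hw.nonneg g) (M.reward_nonneg g a)
  reward_le_one sb a := by
    obtain ⟨s, rfl⟩ := hφ sb
    rw [← hw.sum_fiber s]
    exact Finset.sum_le_sum fun g _ =>
      mul_le_of_le_one_right (hw.nonneg g) (M.reward_le_one g a)
  discount := M.discount

/-- The abstraction `φ` from the ground MDP `MG` to the abstract MDP `MA` has sub-optimality
bounded in `η`, with bounding function `g`: the optimal values of the two MDPs differ by at
most `g η`, and so do the values of each abstract stochastic policy and of its lift to the
ground MDP. -/
structure SuboptBounded (MG : FinMDP SG A) (MA : FinMDP SA A) (φ : SG → SA)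
    (g : ℝ → ℝ) (η : ℝ) : Prop where
  mono : MonotoneOn g (Set.Ici 0)
  zero : g 0 = 0
  opt : ∀ s, |MG.optValue s - MA.optValue (φ s)| ≤ g η
  policy : ∀ π : SA → A → ℝ, (∀ sb, π sb ∈ stdSimplex ℝ A) →
    ∀ s, |MG.value (fun s' => π (φ s')) s - MA.value π (φ s)| ≤ g η

end Abstraction

/-! ### Optimal planning in a finite model -/

section Planning

variable {S A : Type*} [Fintype S] [Fintype A]

/-- The optimal Bellman operator on state-action functions. -/
def bellmanOp (γ : ℝ) (r : S → A → ℝ) (p : S → A → S → ℝ) (Q : S → A → ℝ) : S → A → ℝ :=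
  fun s a => r s a + γ * ∑ s', p s a s' * ⨆ a', Q s' a'

theorem abs_ciSup_sub_le {A : Type*} [Finite A] (u v : A → ℝ) (c : ℝ) (hc : 0 ≤ c)
    (h : ∀ a, |u a - v a| ≤ c) : |(⨆ a, u a) - ⨆ a, v a| ≤ c := by
  rcases isEmpty_or_nonempty A with hA | hA
  · simpa [Real.iSup_of_isEmpty] using hc
  have key : ∀ u v : A → ℝ, (∀ a, |u a - v a| ≤ c) → (⨆ a, u a) ≤ (⨆ a, v a) + c := by
    intro u v h
    refine ciSup_le fun a => ?_
    have h1 := (abs_le.mp (h a)).2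
    have h2 := le_ciSup (Set.finite_range v).bddAbove a
    linarith
  have h1 := key u v h
  have h2 := key v u fun a => by rw [abs_sub_comm]; exact h a
  exact abs_le.mpr ⟨by linarith, by linarith⟩

theorem bellmanOp_contracting (γ : Set.Ico (0 : ℝ) 1) (r : S → A → ℝ) (p : S → A → S → ℝ)
    (hp0 : ∀ s a s', 0 ≤ p s a s') (hp1 : ∀ s a, ∑ s', p s a s' ≤ 1) :
    ContractingWith ⟨(γ : ℝ), γ.2.1⟩ (bellmanOp (γ : ℝ) r p) := by
  refine ⟨by exact_mod_cast γ.2.2, LipschitzWith.of_dist_le_mul fun Q Q' => ?_⟩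
  have hγ : (0 : ℝ) ≤ γ := γ.2.1
  change dist _ _ ≤ (γ : ℝ) * dist Q Q'
  have hnn : 0 ≤ (γ : ℝ) * dist Q Q' := mul_nonneg hγ dist_nonneg
  refine (dist_pi_le_iff hnn).mpr fun s => (dist_pi_le_iff hnn).mpr fun a => ?_
  rw [Real.dist_eq]
  have e : bellmanOp (γ : ℝ) r p Q s a - bellmanOp (γ : ℝ) r p Q' s a
      = γ * ∑ s', p s a s' * ((⨆ a', Q s' a') - ⨆ a', Q' s' a') := by
    simp only [bellmanOp, mul_sub, Finset.sum_sub_distrib]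
    ring
  rw [e, abs_mul, abs_of_nonneg hγ]
  refine mul_le_mul_of_nonneg_left ?_ hγ
  calc |∑ s', p s a s' * ((⨆ a', Q s' a') - ⨆ a', Q' s' a')|
      ≤ ∑ s', |p s a s' * ((⨆ a', Q s' a') - ⨆ a', Q' s' a')| :=
        Finset.abs_sum_le_sum_abs _ _
    _ ≤ ∑ s', p s a s' * dist Q Q' := by
        refine Finset.sum_le_sum fun s' _ => ?_
        rw [abs_mul, abs_of_nonneg (hp0 s a s')]
        refine mul_le_mul_of_nonneg_left ?_ (hp0 s a s')
        refine abs_ciSup_sub_le _ _ _ dist_nonneg fun a' => ?_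
        rw [← Real.dist_eq]
        exact (dist_le_pi_dist (Q s') (Q' s') a').trans (dist_le_pi_dist Q Q' s')
    _ = (∑ s', p s a s') * dist Q Q' := by rw [Finset.sum_mul]
    _ ≤ dist Q Q' := mul_le_of_le_one_left dist_nonneg (hp1 s a)

end Planning

/-! ### MBIE-EB -/

/-- What MBIE-EB remembers: for each `(s, a)`, how often each next state was observed and
the sum of the rewards, over the experiences of `(s, a)` that it has used. -/
structure Memory (S A : Type*) where
  next : S → A → S → ℕ
  rewardSum : S → A → ℝ

namespace Memory

variable {S A : Type*}

/-- The initial, empty memory. -/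
def empty : Memory S A := ⟨fun _ _ _ => 0, fun _ _ => 0⟩

/-- The number `N(s, a)` of experiences of `(s, a)`. -/
def count [Fintype S] (d : Memory S A) (s : S) (a : A) : ℕ := ∑ s', d.next s a s'

open Classical in
/-- Record the experience `(s, a, r, s')`. Only the first `m` experiences of each
state-action pair are used. -/
def update [Fintype S] (m : ℕ) (d : Memory S A) (s : S) (a : A) (r : ℝ) (s' : S) :
    Memory S A :=
  if d.count s a < m then
    { next := fun x b y => d.next x b y + if x = s ∧ b = a ∧ y = s' then 1 else 0
      rewardSum := fun x b => d.rewardSum x b + if x = s ∧ b = a then r else 0 }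
  else d

variable [Fintype S]

/-- The empirical transition probabilities (zero for a pair that was never tried). -/
def empTrans (d : Memory S A) (s : S) (a : A) (s' : S) : ℝ :=
  (d.next s a s' : ℝ) / (d.count s a : ℝ)

/-- The empirical mean reward plus the exploration bonus `β / √N(s, a)`. For a pair that was
never tried this is the maximal Q-value `1 / (1 - γ)`; together with the vanishing
transition probabilities this makes the Q-value of such a pair equal to `1 / (1 - γ)`. -/
def bonusReward (γ β : ℝ) (d : Memory S A) (s : S) (a : A) : ℝ :=
  if d.count s a = 0 then 1 / (1 - γ)
  else d.rewardSum s a / (d.count s a : ℝ) + β / √(d.count s a : ℝ)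

theorem empTrans_nonneg (d : Memory S A) (s : S) (a : A) (s' : S) : 0 ≤ d.empTrans s a s' := by
  unfold empTrans
  positivity

theorem empTrans_sum_le (d : Memory S A) (s : S) (a : A) : ∑ s', d.empTrans s a s' ≤ 1 := by
  unfold empTrans
  rw [← Finset.sum_div]
  have h : (∑ s', (d.next s a s' : ℝ)) = (d.count s a : ℝ) := by
    unfold count
    push_cast
    rfl
  rw [h]
  exact div_self_le_one _

variable [Fintype A]

/-- The optimistic Q-function of MBIE-EB: the unique solution of
`Q(s, a) = R̂(s, a) + γ ∑_{s'} T̂(s' | s, a) max_{a'} Q(s', a') + β / √N(s, a)`,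
with `Q(s, a) = 1 / (1 - γ)` for the pairs that were never tried. -/
def optimisticQ (γ : Set.Ico (0 : ℝ) 1) (β : ℝ) (d : Memory S A) : S → A → ℝ :=
  ContractingWith.fixedPoint (bellmanOp (γ : ℝ) (d.bonusReward γ β) d.empTrans)
    (bellmanOp_contracting γ (d.bonusReward γ β) d.empTrans d.empTrans_nonneg d.empTrans_sum_le)

theorem optimisticQ_of_tried (γ : Set.Ico (0 : ℝ) 1) (β : ℝ) (d : Memory S A) (s : S) (a : A)
    (h : d.count s a ≠ 0) :
    d.optimisticQ γ β s a = d.rewardSum s a / (d.count s a : ℝ)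
      + γ * ∑ s', (d.next s a s' : ℝ) / (d.count s a : ℝ) * (⨆ a', d.optimisticQ γ β s' a')
      + β / √(d.count s a : ℝ) := by
  have hfix := (bellmanOp_contracting γ (d.bonusReward γ β) d.empTrans d.empTrans_nonneg
    d.empTrans_sum_le).fixedPoint_isFixedPt
  have h2 := congrFun (congrFun hfix s) a
  change bellmanOp _ _ _ (d.optimisticQ γ β) s a = d.optimisticQ γ β s a at h2
  rw [← h2]
  simp only [bellmanOp, bonusReward, empTrans, if_neg h]
  ring

theorem optimisticQ_of_untried (γ : Set.Ico (0 : ℝ) 1) (β : ℝ) (d : Memory S A) (s : S) (a : A)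
    (h : d.count s a = 0) : d.optimisticQ γ β s a = 1 / (1 - (γ : ℝ)) := by
  have hfix := (bellmanOp_contracting γ (d.bonusReward γ β) d.empTrans d.empTrans_nonneg
    d.empTrans_sum_le).fixedPoint_isFixedPt
  have h2 := congrFun (congrFun hfix s) a
  change bellmanOp _ _ _ (d.optimisticQ γ β) s a = d.optimisticQ γ β s a at h2
  rw [← h2]
  simp [bellmanOp, bonusReward, empTrans, h]

end Memory

/-- A rule that selects, from a Q-function, a greedy policy (that is, a way to break ties). -/
def IsGreedyRule {S A : Type*} (greedy : (S → A → ℝ) → S → A) : Prop :=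
  ∀ (Q : S → A → ℝ) (s : S) (a : A), Q s a ≤ Q s (greedy Q s)

namespace MBIEEB

variable {S A : Type*} [Fintype S] [Fintype A]

/-- The memory of MBIE-EB with parameters `β` and `m`, run on the MDP `M`, at time `t`, when
the visited states are `x 0, x 1, …`. Actions are greedy for the current optimistic
Q-function. Only `x 0, …, x t` are used. -/
def memory (M : FinMDP S A) (greedy : (S → A → ℝ) → S → A) (β : ℝ) (m : ℕ) (x : ℕ → S) :
    ℕ → Memory S A
  | 0 => Memory.empty
  | t + 1 =>
    let d := memory M greedy β m x t
    let a := greedy (d.optimisticQ M.discount β) (x t)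
    d.update m (x t) a (M.reward (x t) a) (x (t + 1))

/-- The policy `S → A` of MBIE-EB at time `t`. -/
def policy (M : FinMDP S A) (greedy : (S → A → ℝ) → S → A) (β : ℝ) (m : ℕ) (x : ℕ → S)
    (t : ℕ) : S → A :=
  greedy ((memory M greedy β m x t).optimisticQ M.discount β)

open MeasureTheory in
/-- The process `X` of the states visited when MBIE-EB is run on `M`, from an arbitrary initial
distribution: given the states up to time `t`, the next state has the law
`M.trans (X t) a` where `a` is the action that MBIE-EB takes at time `t`. -/
structure IsRun (M : FinMDP S A) (greedy : (S → A → ℝ) → S → A) (β : ℝ) (m : ℕ)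
    {Ω : Type*} [MeasurableSpace Ω] (μ : Measure Ω) (X : ℕ → Ω → S) : Prop where
  measurable : ∀ t s, MeasurableSet {ω | X t ω = s}
  step : ∀ (t : ℕ) (x : ℕ → S),
    μ {ω | ∀ i ≤ t + 1, X i ω = x i} =
      μ {ω | ∀ i ≤ t, X i ω = x i} *
        ENNReal.ofReal (M.trans (x t) (policy M greedy β m x t (x t)) (x (t + 1)))

/-- The bonus constant `β = (1 / (1 - γ)) √(ln (2 |S| |A| m / δ) / 2)`. -/
def bonus (nS nA m : ℕ) (δ γ : ℝ) : ℝ :=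
  1 / (1 - γ) * √(Real.log (2 * nS * nA * m / δ) / 2)

end MBIEEB

/-- The quantity `|S|² |A| / (ε³ (1 - γ)⁶)` times the constant `C` and the `k`-th power of a
logarithm in the problem parameters. As usual in asymptotic notation, `1 / ε` is the large
parameter; for `ε > 1` it is replaced by `1`. -/
def softBound (C : ℝ) (k : ℕ) (nS nA : ℕ) (ε δ γ : ℝ) : ℝ :=
  C * ((nS : ℝ) ^ 2 * nA * (max 1 (1 / ε)) ^ 3 / (1 - γ) ^ 6)
    * Real.log (2 + nS * nA * max 1 (1 / ε) / ((1 - γ) * δ)) ^ k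

end

/-! The ground loss splits at the abstract MDP: passing between the two optimal values, and between
the value of the abstract policy and that of its lift, costs `g η` each. It remains to see that
MBIE-EB in the abstract MDP is `g η`-optimal in the current state at all but few times; this is
`IsRun.measure_not_pac`, which no longer mentions the ground MDP.

Write x = 1 - γ, B = (1 + β)/x and Ṽ for the optimistic value. With high probability the memory is
`Accurate` at all times: empirical means of the fixed function V* are right up to multiples of β/√N,
and no successor is overrepresented by much more than a factor 1 + x/2. Since Ṽ depends on the data,
Hoeffding's inequality is applied to V* only. The difference Ṽ - V* is nonnegative by optimism
(`optValue_le_optimisticV`), so the one-sided relative bound on the counts controls it, and γ(1 +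
x/2) ≤ 1 - x/2 absorbs the factor.

Let Δ be Ṽ minus the value of the current policy; by optimism it dominates the loss. At a pair with
m experiences the memory is frozen, and Δ is at most a small error plus (1 - x/2) times its mean
after the step. Visits to other pairs have to be paid for. Paying B for each would lose a power of
x; but once a pair has n₁ ≤ m experiences, the part of Ṽ above 6/x contracts as well, so that a
visit costs only 6/x. `potential` combines both excesses, and `potential_le_step` is the recursion
P_t ≤ z_t + (1 - x/2) E[P_{t+1} | past], where the sum of the costs z_t is bounded by counting
visits. A multiplicative martingale bound, `measure_exists_le_sum_stepMean`, replaces the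
conditional means by the process itself uniformly in the horizon, which bounds the sum of P over all
times. Each time with P_t ≥ κ uses up κ of this sum; at all other times the loss is at most 2κ.

For ε ≤ 1, κ = ε/2 and m is |S|/(ε²x⁴) up to logarithms and constants. The sum of P is then of order
|S||A|m/x², and division by κ gives |S|²|A|/(ε³x⁶). -/

noncomputable section

/-! ### Ville's inequality along a run -/

open MeasureTheory in
/-- **Ville's inequality** for a process with values in a finite type whose conditional laws
are given by the kernel `K` on cylinders. -/
theorem measure_exists_le_of_supermartingale {S Ω : Type*} [Fintype S] [MeasurableSpace Ω]
    (μ : Measure Ω) [IsProbabilityMeasure μ] (X : ℕ → Ω → S)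
    (hX : ∀ s, MeasurableSet {ω | X 0 ω = s}) (K : ℕ → (ℕ → S) → S → ℝ)
    (hK0 : ∀ t x s, 0 ≤ K t x s)
    (hKadapt : ∀ t x y, (∀ i ≤ t, x i = y i) → K t x = K t y)
    (hstep : ∀ t x, μ {ω | ∀ i ≤ t + 1, X i ω = x i} =
      μ {ω | ∀ i ≤ t, X i ω = x i} * ENNReal.ofReal (K t x (x (t + 1))))
    (W : ℕ → (ℕ → S) → ℝ) (hW0 : ∀ t x, 0 ≤ W t x)
    (hWadapt : ∀ t x y, (∀ i ≤ t, x i = y i) → W t x = W t y)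
    (hinit : ∀ x, W 0 x ≤ 1)
    (hsuper : ∀ t x, ∑ s, K t x s * W (t + 1) (Function.update x (t + 1) s) ≤ W t x)
    (c : ℝ) :
    ENNReal.ofReal c * μ {ω | ∃ t, c ≤ W t (fun i => X i ω)} ≤ 1 := by
  classical
  have hupd : ∀ (t : ℕ) (x : ℕ → S) (s : S), ∀ i ≤ t, Function.update x (t + 1) s i = x i := by
    intro t x s i hi
    exact Function.update_of_ne (by omega) _ _
  -- Optional stopping inside a cylinder, by induction on the remaining horizon `k`. If the level is
  -- reached at time `t`, nothing is left to do; otherwise the event is split according to the next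
  -- state and `hsuper` recombines the pieces.
  have core : ∀ (k t : ℕ) (x : ℕ → S),
      ENNReal.ofReal c * μ ({ω | ∀ i ≤ t, X i ω = x i} ∩
        {ω | ∃ i, t ≤ i ∧ i ≤ t + k ∧ c ≤ W i (fun j => X j ω)}) ≤
      μ {ω | ∀ i ≤ t, X i ω = x i} * ENNReal.ofReal (W t x) := by
    intro k
    induction k with
    | zero =>
      intro t x
      by_cases hc : c ≤ W t x
      · rw [mul_comm]
        exact mul_le_mul' (measure_mono Set.inter_subset_left) (ENNReal.ofReal_le_ofReal hc)
      · have : ({ω | ∀ i ≤ t, X i ω = x i} ∩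
            {ω | ∃ i, t ≤ i ∧ i ≤ t + 0 ∧ c ≤ W i (fun j => X j ω)}) = ∅ := by
          ext ω
          simp only [Set.mem_inter_iff, Set.mem_ofPred_eq, Set.mem_empty_iff_false, iff_false]
          rintro ⟨h1, i, h2, h3, h4⟩
          obtain rfl : i = t := by omega
          rw [hWadapt i _ x h1] at h4
          exact hc h4
        rw [this]
        simp
    | succ k ih =>
      intro t x
      by_cases hc : c ≤ W t x
      · rw [mul_comm]
        exact mul_le_mul' (measure_mono Set.inter_subset_left) (ENNReal.ofReal_le_ofReal hc)
      · have hsub : ({ω | ∀ i ≤ t, X i ω = x i} ∩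
            {ω | ∃ i, t ≤ i ∧ i ≤ t + (k + 1) ∧ c ≤ W i (fun j => X j ω)}) ⊆
            ⋃ s ∈ (Finset.univ : Finset S),
              ({ω | ∀ i ≤ t + 1, X i ω = Function.update x (t + 1) s i} ∩
              {ω | ∃ i, t + 1 ≤ i ∧ i ≤ (t + 1) + k ∧ c ≤ W i (fun j => X j ω)}) := by
          rintro ω ⟨h1, i, h2, h3, h4⟩
          simp only [Finset.mem_univ, Set.iUnion_true, Set.mem_iUnion]
          refine ⟨X (t + 1) ω, ?_, i, ?_, by omega, h4⟩
          · intro j hj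
            rcases Nat.lt_or_ge j (t + 1) with hlt | hge
            · rw [hupd t x _ j (by omega)]
              exact h1 j (by omega)
            · obtain rfl : j = t + 1 := by omega
              simp
          · by_contra hlt
            obtain rfl : i = t := by omega
            rw [hWadapt i _ x h1] at h4
            exact hc h4
        calc ENNReal.ofReal c * μ ({ω | ∀ i ≤ t, X i ω = x i} ∩
              {ω | ∃ i, t ≤ i ∧ i ≤ t + (k + 1) ∧ c ≤ W i (fun j => X j ω)})
            ≤ ENNReal.ofReal c * ∑ s,
              μ ({ω | ∀ i ≤ t + 1, X i ω = Function.update x (t + 1) s i} ∩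
              {ω | ∃ i, t + 1 ≤ i ∧ i ≤ (t + 1) + k ∧ c ≤ W i (fun j => X j ω)}) := by
              gcongr
              exact (measure_mono hsub).trans (measure_biUnion_finset_le _ _)
          _ ≤ ∑ s, μ {ω | ∀ i ≤ t, X i ω = x i} *
                ENNReal.ofReal (K t x s * W (t + 1) (Function.update x (t + 1) s)) := by
              rw [Finset.mul_sum]
              refine Finset.sum_le_sum fun s _ => (ih (t + 1) _).trans (le_of_eq ?_)
              rw [hstep, ENNReal.ofReal_mul (hK0 _ _ _), ← mul_assoc,
                hKadapt t _ x (hupd t x s)]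
              simp only [Function.update_self]
              congr 4
              ext ω
              exact forall₂_congr fun i hi => by rw [hupd t x s i hi]
          _ = μ {ω | ∀ i ≤ t, X i ω = x i} *
                ENNReal.ofReal (∑ s, K t x s * W (t + 1) (Function.update x (t + 1) s)) := by
              rw [ENNReal.ofReal_sum_of_nonneg fun s _ => mul_nonneg (hK0 _ _ _) (hW0 _ _),
                Finset.mul_sum]
          _ ≤ _ := by
              gcongr
              exact hsuper t x
  have hN : ∀ N, ENNReal.ofReal c * μ {ω | ∃ t ≤ N, c ≤ W t (fun i => X i ω)} ≤ 1 := by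
    intro N
    have hsub : {ω | ∃ t ≤ N, c ≤ W t (fun i => X i ω)} ⊆ ⋃ s ∈ (Finset.univ : Finset S),
        ({ω | ∀ i ≤ 0, X i ω = (fun _ => s : ℕ → S) i} ∩
          {ω | ∃ i, 0 ≤ i ∧ i ≤ 0 + N ∧ c ≤ W i (fun j => X j ω)}) := by
      rintro ω ⟨i, h2, h3⟩
      simp only [Finset.mem_univ, Set.iUnion_true, Set.mem_iUnion]
      refine ⟨X 0 ω, ?_, i, by omega, by omega, h3⟩
      intro j hj
      obtain rfl : j = 0 := by omega
      rfl
    calc _ ≤ ENNReal.ofReal c * ∑ s, μ ({ω | ∀ i ≤ 0, X i ω = (fun _ => s : ℕ → S) i} ∩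
          {ω | ∃ i, 0 ≤ i ∧ i ≤ 0 + N ∧ c ≤ W i (fun j => X j ω)}) := by
            gcongr
            exact (measure_mono hsub).trans (measure_biUnion_finset_le _ _)
      _ ≤ ∑ s, μ {ω | X 0 ω = s} := by
            rw [Finset.mul_sum]
            refine Finset.sum_le_sum fun s _ => (core N 0 _).trans ?_
            have h0 : {ω | ∀ i ≤ 0, X i ω = (fun _ => s : ℕ → S) i} = {ω | X 0 ω = s} := by
              ext ω
              simp
            rw [h0]
            refine mul_le_of_le_one_right' ?_
            rw [ENNReal.ofReal_le_one]
            exact hinit _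
      _ = μ (⋃ s ∈ (Finset.univ : Finset S), {ω | X 0 ω = s}) := by
            rw [measure_biUnion_finset ?_ fun s _ => hX s]
            intro s _ s' _ hss
            refine Set.disjoint_left.mpr fun ω h1 h2 => hss ?_
            exact h1.symm.trans h2
      _ ≤ 1 := prob_le_one
  have hU : {ω | ∃ t, c ≤ W t (fun i => X i ω)} =
      ⋃ N, {ω | ∃ t ≤ N, c ≤ W t (fun i => X i ω)} := by
    ext ω
    simp only [Set.mem_ofPred_eq, Set.mem_iUnion]
    exact ⟨fun ⟨t, h⟩ => ⟨t, t, le_rfl, h⟩, fun ⟨N, t, _, h⟩ => ⟨t, h⟩⟩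
  have hmono : Monotone fun N => {ω | ∃ t ≤ N, c ≤ W t (fun i => X i ω)} :=
    fun N N' h ω ⟨t, h1, h2⟩ => ⟨t, h1.trans h, h2⟩
  rw [hU, hmono.measure_iUnion, ENNReal.mul_iSup]
  exact iSup_le hN

namespace MBIEEB

variable {S A : Type*} [Fintype S] [Fintype A]

theorem memory_congr (M : FinMDP S A) (greedy : (S → A → ℝ) → S → A) (β : ℝ) (m : ℕ)
    (t : ℕ) {x y : ℕ → S} (h : ∀ i ≤ t, x i = y i) :
    memory M greedy β m x t = memory M greedy β m y t := by
  induction t with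
  | zero => rfl
  | succ t ih =>
    have e := ih fun i hi => h i (by omega)
    simp only [memory, e, h t (by omega), h (t + 1) le_rfl]

/-- The action that MBIE-EB takes at time `t`. -/
def action (M : FinMDP S A) (greedy : (S → A → ℝ) → S → A) (β : ℝ) (m : ℕ) (x : ℕ → S)
    (t : ℕ) : A := policy M greedy β m x t (x t)

theorem action_congr (M : FinMDP S A) (greedy : (S → A → ℝ) → S → A) (β : ℝ) (m : ℕ)
    (t : ℕ) {x y : ℕ → S} (h : ∀ i ≤ t, x i = y i) :
    action M greedy β m x t = action M greedy β m y t := by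
  simp only [action, policy, memory_congr M greedy β m t h, h t le_rfl]

theorem memory_succ (M : FinMDP S A) (greedy : (S → A → ℝ) → S → A) (β : ℝ) (m : ℕ)
    (x : ℕ → S) (t : ℕ) :
    memory M greedy β m x (t + 1) = (memory M greedy β m x t).update m (x t)
      (action M greedy β m x t) (M.reward (x t) (action M greedy β m x t)) (x (t + 1)) := rfl

open MeasureTheory in
/-- Exponential form of Ville's inequality along a run of MBIE-EB. -/
theorem IsRun.measure_exists_le_sum {M : FinMDP S A} {greedy : (S → A → ℝ) → S → A} {β : ℝ}
    {m : ℕ} {Ω : Type*} [MeasurableSpace Ω] {μ : Measure Ω} [IsProbabilityMeasure μ]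
    {X : ℕ → Ω → S} (hX : IsRun M greedy β m μ X) (ξ : ℕ → (ℕ → S) → ℝ)
    (hadapt : ∀ t x y, (∀ i ≤ t + 1, x i = y i) → ξ t x = ξ t y)
    (hξ : ∀ t x, ∑ s, M.trans (x t) (action M greedy β m x t) s *
      Real.exp (ξ t (Function.update x (t + 1) s)) ≤ 1) (u : ℝ) :
    μ {ω | ∃ t, u ≤ ∑ i ∈ Finset.range t, ξ i (fun j => X j ω)} ≤
      ENNReal.ofReal (Real.exp (-u)) := by
  have h := measure_exists_le_of_supermartingale μ X (fun s => hX.measurable 0 s)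
    (fun t x s => M.trans (x t) (action M greedy β m x t) s)
    (fun _ _ _ => M.trans_nonneg _ _ _)
    (fun t x y h => by
      simp only [action_congr M greedy β m t h, h t le_rfl])
    hX.step (fun t x => Real.exp (∑ i ∈ Finset.range t, ξ i x))
    (fun _ _ => (Real.exp_pos _).le)
    (fun t x y h => by
      congr 1
      refine Finset.sum_congr rfl fun i hi => hadapt i x y fun j hj => h j ?_
      have := Finset.mem_range.mp hi
      omega)
    (fun x => by simp)
    (fun t x => by
      have e : ∀ s, ∑ i ∈ Finset.range (t + 1), ξ i (Function.update x (t + 1) s) =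
          ∑ i ∈ Finset.range t, ξ i x + ξ t (Function.update x (t + 1) s) := by
        intro s
        rw [Finset.sum_range_succ]
        congr 1
        refine Finset.sum_congr rfl fun i hi => hadapt i _ _ fun j hj => ?_
        have := Finset.mem_range.mp hi
        exact Function.update_of_ne (by omega) _ _
      simp only [e, Real.exp_add]
      calc _ = Real.exp (∑ i ∈ Finset.range t, ξ i x) *
            ∑ s, M.trans (x t) (action M greedy β m x t) s *
              Real.exp (ξ t (Function.update x (t + 1) s)) := by
              rw [Finset.mul_sum]
              exact Finset.sum_congr rfl fun s _ => by ring
        _ ≤ _ := mul_le_of_le_one_right (Real.exp_pos _).le (hξ t x))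
    (Real.exp u)
  simp only [Real.exp_le_exp] at h
  calc _ = ENNReal.ofReal (Real.exp (-u)) * (ENNReal.ofReal (Real.exp u) *
        μ {ω | ∃ t, u ≤ ∑ i ∈ Finset.range t, ξ i (fun j => X j ω)}) := by
        rw [← mul_assoc, ← ENNReal.ofReal_mul (Real.exp_pos _).le, ← Real.exp_add]
        simp
    _ ≤ _ := mul_le_of_le_one_right' h

end MBIEEB

/-! ### Counting recorded experiences -/

namespace Memory

variable {S A : Type*} [Fintype S]

open Classical in
theorem update_next (m : ℕ) (d : Memory S A) (s : S) (a : A) (r : ℝ) (s' x : S) (b : A) (y : S) :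
    (d.update m s a r s').next x b y =
      d.next x b y + if d.count s a < m ∧ x = s ∧ b = a ∧ y = s' then 1 else 0 := by
  unfold update
  split_ifs <;> simp_all

open Classical in
theorem update_count (m : ℕ) (d : Memory S A) (s : S) (a : A) (r : ℝ) (s' x : S) (b : A) :
    (d.update m s a r s').count x b =
      d.count x b + if d.count s a < m ∧ x = s ∧ b = a then 1 else 0 := by
  rw [count]
  simp only [update_next, Finset.sum_add_distrib]
  congr 1
  by_cases h : d.count s a < m ∧ x = s ∧ b = a
  · simp [h]
  · rw [if_neg h]
    refine Finset.sum_eq_zero fun y _ => if_neg fun h' => h ⟨h'.1, h'.2.1, h'.2.2.1⟩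

open Classical in
theorem update_rewardSum (m : ℕ) (d : Memory S A) (s : S) (a : A) (r : ℝ) (s' x : S) (b : A) :
    (d.update m s a r s').rewardSum x b =
      d.rewardSum x b + if d.count s a < m ∧ x = s ∧ b = a then r else 0 := by
  unfold update
  split_ifs <;> simp_all

theorem update_of_le {m : ℕ} {d : Memory S A} {s : S} {a : A} (h : m ≤ d.count s a) (r : ℝ)
    (s' : S) : d.update m s a r s' = d := if_neg (not_lt.mpr h)

end Memory

namespace MBIEEB

variable {S A : Type*} [Fintype S] [Fintype A]

theorem memory_count_le (M : FinMDP S A) (greedy : (S → A → ℝ) → S → A) (β : ℝ) (m : ℕ)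
    (x : ℕ → S) (t : ℕ) (s : S) (a : A) : (memory M greedy β m x t).count s a ≤ m := by
  induction t with
  | zero => simp [memory, Memory.empty, Memory.count]
  | succ t ih =>
    rw [memory_succ, Memory.update_count]
    split_ifs with h
    · obtain ⟨h1, rfl, rfl⟩ := h
      omega
    · omega

theorem memory_rewardSum (M : FinMDP S A) (greedy : (S → A → ℝ) → S → A) (β : ℝ) (m : ℕ)
    (x : ℕ → S) (t : ℕ) (s : S) (a : A) : (memory M greedy β m x t).rewardSum s a =
      (memory M greedy β m x t).count s a * M.reward s a := by
  induction t with
  | zero => simp [memory, Memory.empty, Memory.count]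
  | succ t ih =>
    rw [memory_succ, Memory.update_count, Memory.update_rewardSum, ih]
    split_ifs with h
    · obtain ⟨h1, rfl, rfl⟩ := h
      push_cast
      ring
    · simp

-- Every recorded experience of `(s, a)` happens at exactly one time, so a sum over time, to which
-- the supermartingale bound applies, is a linear statistic of the memory.
open Classical in
theorem sum_range_ite_eq_sum_next (M : FinMDP S A) (greedy : (S → A → ℝ) → S → A) (β : ℝ)
    (m : ℕ) (x : ℕ → S) (s : S) (a : A) (h : S → ℝ) (t : ℕ) :
    ∑ i ∈ Finset.range t, (if (memory M greedy β m x i).count s a < m ∧ s = x i ∧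
        a = action M greedy β m x i then h (x (i + 1)) else 0) =
      ∑ y, (memory M greedy β m x t).next s a y * h y := by
  induction t with
  | zero => simp [memory, Memory.empty]
  | succ t ih =>
    rw [Finset.sum_range_succ, ih, memory_succ]
    simp only [Memory.update_next]
    push_cast
    simp only [add_mul, Finset.sum_add_distrib]
    congr 1
    by_cases hc : (memory M greedy β m x t).count s a < m ∧ s = x t ∧
        a = action M greedy β m x t
    · obtain ⟨h1, rfl, rfl⟩ := hc
      simp [h1]
    · rw [if_neg hc]
      refine (Finset.sum_eq_zero fun y _ => ?_).symm
      rw [if_neg, zero_mul]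
      rintro ⟨h1, h2, h3, -⟩
      subst h2 h3
      exact hc ⟨h1, rfl, rfl⟩

-- A visit that is counted here raises the minimum of `k` and the count of its pair by one; `k ≤ m`
-- ensures that it is recorded. The sum of these truncated counts over all pairs never exceeds the
-- right-hand side.
open Classical in
theorem sum_range_visit_le (M : FinMDP S A) (greedy : (S → A → ℝ) → S → A) (β : ℝ)
    (m : ℕ) (x : ℕ → S) {k : ℕ} (hk : k ≤ m) (t : ℕ) :
    ∑ i ∈ Finset.range t, (if (memory M greedy β m x i).count (x i)
        (action M greedy β m x i) < k then 1 else 0) ≤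
      Fintype.card S * Fintype.card A * k := by
  have key : ∑ i ∈ Finset.range t, (if (memory M greedy β m x i).count (x i)
        (action M greedy β m x i) < k then 1 else 0) ≤
      ∑ p : S × A, min ((memory M greedy β m x t).count p.1 p.2) k := by
    induction t with
    | zero => simp
    | succ t ih =>
      rw [Finset.sum_range_succ, memory_succ]
      split_ifs with h
      · have hlt : ∑ p : S × A, min ((memory M greedy β m x t).count p.1 p.2) k <
            ∑ p : S × A, min (((memory M greedy β m x t).update m (x t)
              (action M greedy β m x t) (M.reward (x t) (action M greedy β m x t))
              (x (t + 1))).count p.1 p.2) k := by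
          refine Finset.sum_lt_sum (fun p _ => ?_)
            ⟨(x t, action M greedy β m x t), Finset.mem_univ _, ?_⟩
          · rw [Memory.update_count]
            exact min_le_min_right _ (by omega)
          · rw [Memory.update_count]
            simp only [and_self, and_true]
            rw [if_pos (h.trans_le hk)]
            omega
        omega
      · refine (add_zero _).le.trans (ih.trans (Finset.sum_le_sum fun p _ => ?_))
        rw [Memory.update_count]
        exact min_le_min_right _ (by omega)
  refine key.trans ((Finset.sum_le_sum fun p _ => min_le_right _ _).trans ?_)
  simp

open MeasureTheory in
/-- Large deviations of the recorded successors of a state-action pair, uniformly in time. -/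
theorem IsRun.measure_exists_le_sum_next {M : FinMDP S A} {greedy : (S → A → ℝ) → S → A}
    {β : ℝ} {m : ℕ} {Ω : Type*} [MeasurableSpace Ω] {μ : Measure Ω} [IsProbabilityMeasure μ]
    {X : ℕ → Ω → S} (hX : IsRun M greedy β m μ X) (s : S) (a : A) (h : S → ℝ)
    (hh : ∑ y, M.trans s a y * Real.exp (h y) ≤ 1) (u : ℝ) :
    μ {ω | ∃ t, u ≤ ∑ y, (memory M greedy β m (fun i => X i ω) t).next s a y * h y} ≤
      ENNReal.ofReal (Real.exp (-u)) := by
  classical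
  have := hX.measure_exists_le_sum
    (fun i x => if (memory M greedy β m x i).count s a < m ∧ s = x i ∧
        a = action M greedy β m x i then h (x (i + 1)) else 0)
    (fun t x y hxy => by
      have h1 : ∀ i ≤ t, x i = y i := fun i hi => hxy i (by omega)
      simp only [memory_congr M greedy β m t h1, action_congr M greedy β m t h1, h1 t le_rfl,
        hxy (t + 1) le_rfl])
    (fun t x => by
      have h1 : ∀ z, ∀ i ≤ t, Function.update x (t + 1) z i = x i := fun z i hi =>
        Function.update_of_ne (by omega) _ _
      simp only [fun z => memory_congr M greedy β m t (h1 z),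
        fun z => action_congr M greedy β m t (h1 z), fun z => h1 z t le_rfl,
        Function.update_self]
      by_cases hc : (memory M greedy β m x t).count s a < m ∧ s = x t ∧
        a = action M greedy β m x t
      · simp only [if_pos hc]
        obtain ⟨-, rfl, rfl⟩ := hc
        exact hh
      · simp only [if_neg hc, Real.exp_zero, mul_one]
        exact (M.trans_sum _ _).le) u
  simpa only [sum_range_ite_eq_sum_next] using this

end MBIEEB

/-! ### Exponential moments of finite distributions -/

open MeasureTheory ProbabilityTheory in
/-- **Hoeffding's lemma** for a finite probability vector. -/
theorem sum_mul_exp_le_one_of_mem_Icc {S : Type*} [Fintype S] {p f : S → ℝ} {a b : ℝ}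
    (hp0 : ∀ y, 0 ≤ p y) (hp1 : ∑ y, p y = 1) (hf : ∀ y, f y ∈ Set.Icc a b) (θ : ℝ) :
    ∑ y, p y * Real.exp (θ * (f y - ∑ z, p z * f z) - θ ^ 2 * (b - a) ^ 2 / 8) ≤ 1 := by
  let : MeasurableSpace S := ⊤
  let P : PMF S := PMF.ofFintype (fun y => ENNReal.ofReal (p y)) (by
    rw [← ENNReal.ofReal_sum_of_nonneg fun y _ => hp0 y, hp1, ENNReal.ofReal_one])
  have hint : ∀ h : S → ℝ, ∫ y, h y ∂P.toMeasure = ∑ y, p y * h y := by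
    intro h
    rw [PMF.integral_eq_sum]
    refine Finset.sum_congr rfl fun y _ => ?_
    simp [P, ENNReal.toReal_ofReal (hp0 y)]
  have h := (hasSubgaussianMGF_of_mem_Icc (μ := P.toMeasure) (X := f) (a := a) (b := b)
    (measurable_from_top.aemeasurable) (Filter.Eventually.of_forall hf)).mgf_le θ
  rw [mgf, hint, hint] at h
  have hc : (((‖b - a‖₊ / 2) ^ 2 : NNReal) : ℝ) * θ ^ 2 / 2 = θ ^ 2 * (b - a) ^ 2 / 8 := by
    push_cast
    rw [Real.norm_eq_abs, div_pow, sq_abs]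
    ring
  rw [hc] at h
  simp only [Real.exp_sub _ (θ ^ 2 * (b - a) ^ 2 / 8), ← mul_div_assoc, ← Finset.sum_div]
  rw [div_le_one (Real.exp_pos _)]
  exact h

/-- The exponential moment of a Bernoulli variable. -/
theorem sum_mul_exp_indicator_le_one {S : Type*} [Fintype S] [DecidableEq S] {p : S → ℝ}
    (hp1 : ∑ y, p y = 1) (s : S) (θ : ℝ) :
    ∑ y, p y * Real.exp (θ * (if y = s then 1 else 0) - (Real.exp θ - 1) * p s) ≤ 1 := by
  -- The exponential of θ times an indicator is 1 plus (exp θ - 1) times it, so the sum becomes (1 +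
  -- v) exp(-v) with v = (exp θ - 1) p(s).
  have e : ∀ y, p y * Real.exp (θ * (if y = s then 1 else 0) - (Real.exp θ - 1) * p s) =
      (p y + if y = s then p s * (Real.exp θ - 1) else 0) *
        Real.exp (-((Real.exp θ - 1) * p s)) := by
    intro y
    rw [sub_eq_add_neg, Real.exp_add]
    split_ifs with h
    · subst h
      simp only [mul_one]
      ring
    · simp
  simp only [e, ← Finset.sum_mul, Finset.sum_add_distrib, hp1, Finset.sum_ite_eq',
    Finset.mem_univ, if_true]
  rw [Real.exp_neg, ← div_eq_mul_inv, div_le_one (Real.exp_pos _)]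
  have := Real.add_one_le_exp ((Real.exp θ - 1) * p s)
  linarith

/-! ### Values of deterministic policies -/

namespace FinMDP

variable {S A : Type*} [Fintype S] [Fintype A] (M : FinMDP S A)

theorem policyReward_det (π : S → A) (s : S) :
    M.policyReward (det π) s = M.reward s (π s) := by
  classical
  simp [policyReward, det]

theorem policyMatrix_det_mulVec (π : S → A) (f : S → ℝ) (s : S) :
    (M.policyMatrix (det π)).mulVec f s = ∑ s', M.trans s (π s) s' * f s' := by
  classical
  simp [policyMatrix, det, Matrix.mulVec, dotProduct]

open Classical in
theorem policyMatrix_pow_mem_Icc (π : S → A) (t : ℕ) (s : S) :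
    ((M.policyMatrix (det π) ^ t).mulVec (M.policyReward (det π))) s ∈ Set.Icc (0 : ℝ) 1 := by
  induction t generalizing s with
  | zero =>
    rw [pow_zero, Matrix.one_mulVec, policyReward_det]
    exact ⟨M.reward_nonneg _ _, M.reward_le_one _ _⟩
  | succ t ih =>
    rw [pow_succ', ← Matrix.mulVec_mulVec, policyMatrix_det_mulVec]
    refine ⟨Finset.sum_nonneg fun y _ => mul_nonneg (M.trans_nonneg _ _ _) (ih y).1, ?_⟩
    rw [← M.trans_sum s (π s)]
    exact Finset.sum_le_sum fun y _ => mul_le_of_le_one_right (M.trans_nonneg _ _ _) (ih y).2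

open Classical in
theorem summable_value (π : S → A) (s : S) : Summable fun t : ℕ => (M.discount : ℝ) ^ t *
    ((M.policyMatrix (det π) ^ t).mulVec (M.policyReward (det π))) s := by
  refine Summable.of_nonneg_of_le (fun t => ?_) (fun t => ?_)
    (summable_geometric_of_lt_one M.discount.2.1 M.discount.2.2)
  · exact mul_nonneg (pow_nonneg M.discount.2.1 _) (M.policyMatrix_pow_mem_Icc π t s).1
  · exact mul_le_of_le_one_right (pow_nonneg M.discount.2.1 _)
      (M.policyMatrix_pow_mem_Icc π t s).2

/-- The Bellman equation of a deterministic policy. -/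
theorem value_det (π : S → A) (s : S) : M.value (det π) s =
    M.reward s (π s) + M.discount * ∑ s', M.trans s (π s) s' * M.value (det π) s' := by
  classical
  have h := (M.summable_value π s).tsum_eq_zero_add
  rw [value, h]
  congr 1
  · simp [policyReward_det]
  · simp only [pow_succ', ← Matrix.mulVec_mulVec, policyMatrix_det_mulVec, mul_assoc]
    rw [tsum_mul_left]
    congr 1
    simp only [value, ← tsum_mul_left]
    rw [← Summable.tsum_finsetSum fun s' _ => (M.summable_value π s').mul_left _]
    refine tsum_congr fun t => ?_
    rw [Finset.mul_sum]
    refine Finset.sum_congr rfl fun s' _ => by ring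

theorem value_det_nonneg (π : S → A) (s : S) : 0 ≤ M.value (det π) s := by
  classical
  exact tsum_nonneg fun t =>
    mul_nonneg (pow_nonneg M.discount.2.1 _) (M.policyMatrix_pow_mem_Icc π t s).1

theorem value_det_le (π : S → A) (s : S) : M.value (det π) s ≤ 1 / (1 - M.discount) := by
  classical
  rw [one_div, ← tsum_geometric_of_lt_one M.discount.2.1 M.discount.2.2]
  exact Summable.tsum_le_tsum (fun t => mul_le_of_le_one_right (pow_nonneg M.discount.2.1 _)
    (M.policyMatrix_pow_mem_Icc π t s).2) (M.summable_value π s)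
    (summable_geometric_of_lt_one M.discount.2.1 M.discount.2.2)

theorem value_det_le_optValue (π : S → A) (s : S) : M.value (det π) s ≤ M.optValue s :=
  le_ciSup (f := fun π : S → A => M.value (det π) s) (Set.finite_range _).bddAbove π

variable [Nonempty A]

theorem exists_value_det_eq_optValue (s : S) : ∃ π : S → A, M.value (det π) s = M.optValue s :=
  exists_eq_ciSup_of_finite

theorem optValue_mem_Icc (s : S) : M.optValue s ∈ Set.Icc 0 (1 / (1 - (M.discount : ℝ))) := by
  obtain ⟨π, hπ⟩ := M.exists_value_det_eq_optValue s
  rw [← hπ]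
  exact ⟨M.value_det_nonneg π s, M.value_det_le π s⟩

/-- The state-action value function that is obtained by one step of look-ahead. -/
def optQ (s : S) (a : A) : ℝ := M.reward s a + M.discount * ∑ s', M.trans s a s' * M.optValue s'

/-- A policy that is best at `s` does no better than its first action followed by optimal values.
Only this half of the Bellman optimality equation is needed. -/
theorem exists_optValue_le_optQ (s : S) : ∃ a, M.optValue s ≤ M.optQ s a := by
  obtain ⟨π, hπ⟩ := M.exists_value_det_eq_optValue s
  refine ⟨π s, ?_⟩
  rw [← hπ, value_det, optQ]
  have hγ := M.discount.2.1
  gcongr with s' _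
  · exact M.trans_nonneg _ _ _
  · exact M.value_det_le_optValue π s'

theorem optQ_le (s : S) (a : A) : M.optQ s a ≤ 1 / (1 - (M.discount : ℝ)) := by
  have hγ := M.discount.2.1
  have h1 : (0 : ℝ) < 1 - M.discount := sub_pos.mpr M.discount.2.2
  have h : ∑ s', M.trans s a s' * M.optValue s' ≤ 1 / (1 - (M.discount : ℝ)) := by
    calc _ ≤ ∑ s', M.trans s a s' * (1 / (1 - (M.discount : ℝ))) :=
          Finset.sum_le_sum fun y _ =>
            mul_le_mul_of_nonneg_left (M.optValue_mem_Icc y).2 (M.trans_nonneg _ _ _)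
      _ = _ := by rw [← Finset.sum_mul, M.trans_sum, one_mul]
  calc M.optQ s a ≤ 1 + M.discount * (1 / (1 - (M.discount : ℝ))) := by
        unfold optQ
        gcongr
        exact M.reward_le_one s a
    _ = _ := by
        field_simp
        ring

end FinMDP

/-! ### Comparison principle and optimistic values -/

section Comparison

variable {S A : Type*} [Fintype S] [Fintype A] [Nonempty A]

/-- Comparison of an approximate subsolution and a supersolution of the Bellman equation. -/
theorem le_add_of_le_bellmanOp {γ : ℝ} (hγ0 : 0 ≤ γ) (hγ1 : γ < 1) {r : S → A → ℝ}
    {p : S → A → S → ℝ} (hp0 : ∀ s a s', 0 ≤ p s a s') (hp1 : ∀ s a, ∑ s', p s a s' ≤ 1)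
    {Q₁ Q₂ : S → A → ℝ} {c : ℝ} (hc : 0 ≤ c)
    (h1 : ∀ s a, Q₁ s a ≤ bellmanOp γ r p Q₁ s a + (1 - γ) * c)
    (h2 : ∀ s a, bellmanOp γ r p Q₂ s a ≤ Q₂ s a) (s : S) (a : A) : Q₁ s a ≤ Q₂ s a + c := by
  have : Nonempty (S × A) := ⟨(s, a)⟩
  obtain ⟨⟨s₀, a₀⟩, hmax⟩ := Finite.exists_max fun q : S × A => Q₁ q.1 q.2 - Q₂ q.1 q.2
  have hmax' : ∀ s a, Q₁ s a - Q₂ s a ≤ Q₁ s₀ a₀ - Q₂ s₀ a₀ := fun s a => hmax (s, a)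
  set D := Q₁ s₀ a₀ - Q₂ s₀ a₀ with hD
  suffices hDc : D ≤ c by
    have := hmax' s a
    linarith
  -- At the maximiser of Q₁ - Q₂ the hypotheses give D ≤ γD + (1 - γ)c. As the rows of `p` may sum
  -- to less than one (untried pairs), this also needs D ≥ 0, which follows from c < D.
  by_contra! hcon
  have hV : ∀ s', (⨆ a', Q₁ s' a') - (⨆ a', Q₂ s' a') ≤ D := by
    intro s'
    rw [sub_le_iff_le_add]
    refine ciSup_le fun a' => ?_
    have h3 := hmax' s' a'
    have h4 := le_ciSup (Set.finite_range (Q₂ s')).bddAbove a'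
    linarith
  have h3 : bellmanOp γ r p Q₁ s₀ a₀ - bellmanOp γ r p Q₂ s₀ a₀ ≤ γ * D := by
    have e : bellmanOp γ r p Q₁ s₀ a₀ - bellmanOp γ r p Q₂ s₀ a₀
        = γ * ∑ s', p s₀ a₀ s' * ((⨆ a', Q₁ s' a') - ⨆ a', Q₂ s' a') := by
      simp only [bellmanOp, mul_sub, Finset.sum_sub_distrib]
      ring
    rw [e]
    refine mul_le_mul_of_nonneg_left ?_ hγ0
    calc _ ≤ ∑ s', p s₀ a₀ s' * D :=
          Finset.sum_le_sum fun s' _ => mul_le_mul_of_nonneg_left (hV s') (hp0 _ _ _)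
      _ = (∑ s', p s₀ a₀ s') * D := by rw [Finset.sum_mul]
      _ ≤ D := mul_le_of_le_one_left (hc.trans hcon.le) (hp1 _ _)
  have h4 := h1 s₀ a₀
  have h5 := h2 s₀ a₀
  nlinarith

end Comparison

namespace Memory

variable {S A : Type*} [Fintype S]

/-- The recorded rewards are those of the MDP `M`. -/
def RewardsOf (d : Memory S A) (M : FinMDP S A) : Prop :=
  ∀ s a, d.rewardSum s a = d.count s a * M.reward s a

theorem sum_next (d : Memory S A) (s : S) (a : A) :
    ∑ y, (d.next s a y : ℝ) = d.count s a := by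
  unfold count
  push_cast
  rfl

theorem sum_next_mul_le (d : Memory S A) (s : S) (a : A) {f : S → ℝ} {B : ℝ}
    (hf : ∀ y, f y ≤ B) : ∑ y, (d.next s a y : ℝ) * f y ≤ d.count s a * B := by
  rw [← sum_next, Finset.sum_mul]
  exact Finset.sum_le_sum fun y _ => mul_le_mul_of_nonneg_left (hf y) (Nat.cast_nonneg _)

theorem sum_empTrans_mul (d : Memory S A) (s : S) (a : A) (f : S → ℝ) :
    ∑ y, d.empTrans s a y * f y = (∑ y, (d.next s a y : ℝ) * f y) / d.count s a := by
  rw [Finset.sum_div]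
  exact Finset.sum_congr rfl fun y _ => by rw [empTrans]; ring

theorem RewardsOf.update {M : FinMDP S A} {d : Memory S A} (hd : d.RewardsOf M) (m : ℕ) (s : S) (a : A) (s' : S) :
    (d.update m s a (M.reward s a) s').RewardsOf M := by
  intro x b
  rw [update_rewardSum, update_count, hd x b]
  split_ifs with h
  · obtain ⟨-, rfl, rfl⟩ := h
    push_cast
    ring
  · simp

variable [Fintype A]

theorem bellmanOp_optimisticQ (γ : Set.Ico (0 : ℝ) 1) (β : ℝ) (d : Memory S A) :
    bellmanOp (γ : ℝ) (d.bonusReward γ β) d.empTrans (d.optimisticQ γ β) = d.optimisticQ γ β :=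
  (bellmanOp_contracting γ (d.bonusReward γ β) d.empTrans d.empTrans_nonneg
    d.empTrans_sum_le).fixedPoint_isFixedPt

/-- The optimistic value function of MBIE-EB. -/
def optimisticV (γ : Set.Ico (0 : ℝ) 1) (β : ℝ) (d : Memory S A) (s : S) : ℝ :=
  ⨆ a, d.optimisticQ γ β s a

theorem optimisticQ_le_optimisticV (γ : Set.Ico (0 : ℝ) 1) (β : ℝ) (d : Memory S A) (s : S)
    (a : A) : d.optimisticQ γ β s a ≤ d.optimisticV γ β s :=
  le_ciSup (f := fun a => d.optimisticQ γ β s a) (Set.finite_range _).bddAbove a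

variable {M : FinMDP S A} {β : ℝ} {d : Memory S A}

theorem optimisticQ_eq (hd : d.RewardsOf M) {s : S} {a : A} (h : d.count s a ≠ 0) :
    d.optimisticQ M.discount β s a = M.reward s a + β / √(d.count s a : ℝ) + M.discount *
      ((∑ y, (d.next s a y : ℝ) * d.optimisticV M.discount β y) / d.count s a) := by
  have h0 : (d.count s a : ℝ) ≠ 0 := by exact_mod_cast h
  rw [← bellmanOp_optimisticQ, bellmanOp, bonusReward, if_neg h, ← sum_empTrans_mul, hd s a,
    mul_div_cancel_left₀ _ h0]
  rfl

variable [Nonempty A]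

/-- The zero function is a subsolution of the optimistic equation. -/
theorem optimisticQ_nonneg (hd : d.RewardsOf M) (hβ : 0 ≤ β) (s : S) (a : A) :
    0 ≤ d.optimisticQ M.discount β s a := by
  have hγ1 : (0 : ℝ) < 1 - M.discount := sub_pos.mpr M.discount.2.2
  have := le_add_of_le_bellmanOp M.discount.2.1 M.discount.2.2 d.empTrans_nonneg
    d.empTrans_sum_le (r := d.bonusReward M.discount β) (Q₁ := fun _ _ => 0) (c := 0) le_rfl
    (fun s a => by
      simp only [bellmanOp, ciSup_const, mul_zero, Finset.sum_const_zero, add_zero, bonusReward]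
      split_ifs with h
      · positivity
      · rw [hd s a]
        have := M.reward_nonneg s a
        positivity)
    (fun s a => (congrFun (congrFun (d.bellmanOp_optimisticQ M.discount β) s) a).le) s a
  simpa using this

theorem optimisticV_nonneg (hd : d.RewardsOf M) (hβ : 0 ≤ β) (s : S) :
    0 ≤ d.optimisticV M.discount β s :=
  Real.iSup_nonneg fun a => optimisticQ_nonneg hd hβ s a

/-- The constant on the right is a supersolution, as reward plus bonus of a tried pair is at most 1
+ β. -/
theorem optimisticQ_le (hd : d.RewardsOf M) (hβ : 0 ≤ β) (s : S) (a : A) :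
    d.optimisticQ M.discount β s a ≤ (1 + β) / (1 - M.discount) := by
  have hγ0 := M.discount.2.1
  have hγ1 : (0 : ℝ) < 1 - M.discount := sub_pos.mpr M.discount.2.2
  have := le_add_of_le_bellmanOp M.discount.2.1 M.discount.2.2 d.empTrans_nonneg
    d.empTrans_sum_le (r := d.bonusReward M.discount β)
    (Q₂ := fun _ _ => (1 + β) / (1 - M.discount)) (c := 0) le_rfl
    (fun s a => by
      rw [mul_zero, add_zero]
      exact (congrFun (congrFun (d.bellmanOp_optimisticQ M.discount β) s) a).ge)
    (fun s a => by
      simp only [bellmanOp, ciSup_const, ← Finset.sum_mul, bonusReward]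
      have hB : 0 ≤ (1 + β) / (1 - (M.discount : ℝ)) := by positivity
      split_ifs with h
      · have e : ∑ y, d.empTrans s a y = 0 := by
          simp [empTrans, h]
        rw [e, zero_mul, mul_zero, add_zero]
        gcongr
        linarith
      · have h1 : (1 : ℝ) ≤ d.count s a := by exact_mod_cast Nat.one_le_iff_ne_zero.mpr h
        have h2 : d.rewardSum s a / d.count s a ≤ 1 := by
          rw [hd s a, mul_div_cancel_left₀ _ (by positivity)]
          exact M.reward_le_one s a
        have h3 : β / √(d.count s a : ℝ) ≤ β := div_le_self hβ (Real.one_le_sqrt.mpr h1)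
        have h4 : (∑ y, d.empTrans s a y) * ((1 + β) / (1 - (M.discount : ℝ))) ≤
            (1 + β) / (1 - (M.discount : ℝ)) :=
          mul_le_of_le_one_left hB (d.empTrans_sum_le s a)
        have h5 := mul_le_mul_of_nonneg_left h4 hγ0
        have h6 : 1 + β + M.discount * ((1 + β) / (1 - (M.discount : ℝ))) =
            (1 + β) / (1 - (M.discount : ℝ)) := by
          field_simp
          ring
        linarith) s a
  simpa using this

theorem optimisticV_le (hd : d.RewardsOf M) (hβ : 0 ≤ β) (s : S) :
    d.optimisticV M.discount β s ≤ (1 + β) / (1 - M.discount) :=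
  ciSup_le fun a => optimisticQ_le hd hβ s a

/-- Optimism: the optimistic values dominate the optimal ones, if the empirical means of the
optimal value at the successor states are not much too small. -/
theorem optValue_le_optimisticV (hd : d.RewardsOf M)
    (h : ∀ s a, d.count s a * ∑ y, M.trans s a y * M.optValue y -
      ∑ y, (d.next s a y : ℝ) * M.optValue y ≤ √(d.count s a) * β) (hβ : 0 ≤ β) (s : S) :
    M.optValue s ≤ d.optimisticV M.discount β s := by
  have hγ0 := M.discount.2.1
  have hVle : ∀ s, M.optValue s ≤ ⨆ a, M.optQ s a := fun s => by
    obtain ⟨a, ha⟩ := M.exists_optValue_le_optQ s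
    exact ha.trans (le_ciSup (f := fun a => M.optQ s a) (Set.finite_range _).bddAbove a)
  refine (hVle s).trans (ciSup_mono (Set.finite_range _).bddAbove fun a => ?_)
  -- `optQ` is a subsolution of the optimistic equation: an untried pair has the maximal value, and
  -- for a tried one the bonus β/√N outweighs the possible shortfall of the empirical mean.
  have := le_add_of_le_bellmanOp M.discount.2.1 M.discount.2.2 d.empTrans_nonneg
    d.empTrans_sum_le (r := d.bonusReward M.discount β) (Q₁ := M.optQ) (c := 0) le_rfl
    (fun s a => by
      rw [mul_zero, add_zero, bellmanOp, bonusReward]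
      split_ifs with h0
      · have e : ∀ y, d.empTrans s a y = 0 := fun y => by simp [empTrans, h0]
        simp only [e, zero_mul, Finset.sum_const_zero, mul_zero, add_zero]
        exact M.optQ_le s a
      · have h1 : (0 : ℝ) < d.count s a := by exact_mod_cast Nat.pos_of_ne_zero h0
        have h2 : ∑ y, M.trans s a y * M.optValue y ≤
            ∑ y, d.empTrans s a y * (⨆ a', M.optQ y a') + β / √(d.count s a : ℝ) := by
          calc _ ≤ ∑ y, d.empTrans s a y * M.optValue y + β / √(d.count s a : ℝ) := by
                have hs : √(d.count s a : ℝ) ≠ 0 := (Real.sqrt_pos.mpr h1).ne'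
                have e : β / √(d.count s a : ℝ) = √(d.count s a : ℝ) * β / d.count s a := by
                  rw [div_eq_div_iff hs h1.ne', mul_right_comm, Real.mul_self_sqrt h1.le,
                    mul_comm]
                rw [sum_empTrans_mul, e, ← add_div, le_div_iff₀ h1]
                have := h s a
                linarith
            _ ≤ _ := by
                gcongr with y _
                · exact d.empTrans_nonneg _ _ _
                · exact hVle y
        have h3 := mul_le_mul_of_nonneg_left h2 hγ0
        have h4 : M.discount * (β / √(d.count s a : ℝ)) ≤ β / √(d.count s a : ℝ) :=
          mul_le_of_le_one_left (by positivity) M.discount.2.2.le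
        rw [hd s a, mul_div_cancel_left₀ _ h1.ne', FinMDP.optQ]
        linarith)
    (fun s a => (congrFun (congrFun (d.bellmanOp_optimisticQ M.discount β) s) a).le) s a
  simpa using this

/-- One more experience of a pair changes the optimistic values only a little. -/
theorem optimisticV_le_update (hd : d.RewardsOf M) (hβ : 0 ≤ β) (m : ℕ) {s : S} {a : A}
    (h0 : d.count s a ≠ 0) (s' y : S) : d.optimisticV M.discount β y ≤
      (d.update m s a (M.reward s a) s').optimisticV M.discount β y +
        2 * ((1 + β) / (1 - M.discount)) / (d.count s a * (1 - M.discount)) := by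
  classical
  have hγ0 := M.discount.2.1
  have hγ1 : (0 : ℝ) < 1 - M.discount := sub_pos.mpr M.discount.2.2
  have hn : (0 : ℝ) < d.count s a := by exact_mod_cast Nat.pos_of_ne_zero h0
  set B := (1 + β) / (1 - (M.discount : ℝ)) with hB
  have hβB : β ≤ B := by
    rw [hB, le_div_iff₀ hγ1]
    nlinarith
  have hB0 : 0 ≤ B := hβ.trans hβB
  set d' := d.update m s a (M.reward s a) s' with hd'
  set c := 2 * B / (d.count s a * (1 - (M.discount : ℝ))) with hc
  have hc0 : 0 ≤ c := by positivity
  have hxc : (1 - (M.discount : ℝ)) * c = 2 * B / d.count s a := by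
    rw [hc]
    field_simp
  -- The old Q-function is a subsolution of the new equation up to a defect of 2B/n at the changed
  -- pair: B/n for the mean over successors and β/n ≤ B/n for the bonus. Comparison divides the
  -- defect by 1 - γ, whence `c`.
  have key : ∀ x b, d.optimisticQ M.discount β x b ≤
      bellmanOp (M.discount : ℝ) (d'.bonusReward M.discount β) d'.empTrans
        (d.optimisticQ M.discount β) x b + (1 - M.discount) * c := by
    intro x b
    by_cases hxb : d.count s a < m ∧ x = s ∧ b = a
    · obtain ⟨hlt, rfl, rfl⟩ := hxb
      have hcount : d'.count x b = d.count x b + 1 := by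
        rw [hd', update_count]
        simp [hlt]
      have hsum : ∑ z, (d'.next x b z : ℝ) * d.optimisticV M.discount β z =
          ∑ z, (d.next x b z : ℝ) * d.optimisticV M.discount β z +
            d.optimisticV M.discount β s' := by
        rw [hd']
        simp [update_next, hlt, add_mul, Finset.sum_add_distrib]
      have hr : d'.rewardSum x b / d'.count x b = M.reward x b := by
        rw [hd.update m x b s' x b, mul_div_cancel_left₀]
        rw [hcount]
        positivity
      have e1 : bellmanOp (M.discount : ℝ) (d'.bonusReward M.discount β) d'.empTrans
          (d.optimisticQ M.discount β) x b = M.reward x b + β / √(d'.count x b : ℝ) +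
          M.discount * ((∑ z, (d'.next x b z : ℝ) * d.optimisticV M.discount β z) /
            d'.count x b) := by
        rw [bellmanOp, bonusReward, if_neg (by omega), hr, ← sum_empTrans_mul]
        rfl
      rw [e1, optimisticQ_eq hd h0, hsum, hcount, hxc]
      set n : ℝ := (d.count x b : ℝ) with hndef
      set q := ∑ z, (d.next x b z : ℝ) * d.optimisticV M.discount β z
      have hq : q ≤ n * B := sum_next_mul_le d x b fun z => optimisticV_le hd hβ z
      have hq0 : 0 ≤ q := Finset.sum_nonneg fun z _ =>
        mul_nonneg (Nat.cast_nonneg _) (optimisticV_nonneg hd hβ z)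
      have hv0 := optimisticV_nonneg hd hβ s'
      have h1n : (1 : ℝ) ≤ n := by
        rw [hndef]
        exact_mod_cast Nat.one_le_iff_ne_zero.mpr h0
      push_cast
      have ht : q / n ≤ (q + d.optimisticV M.discount β s') / (n + 1) + B / n := by
        have : q / n ≤ q / (n + 1) + B / n := by
          rw [div_add_div _ _ (by positivity) (by positivity),
            div_le_div_iff₀ (by positivity) (by positivity)]
          nlinarith [mul_le_mul_of_nonneg_left hq hn.le, mul_nonneg hn.le hB0]
        refine this.trans ?_
        gcongr
        linarith
      have ht' := mul_le_mul_of_nonneg_left ht hγ0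
      have hs : β / √n ≤ β / √(n + 1) + β / n := by
        have hs1 : 1 / √n ≤ 1 / √(n + 1) + 1 / n := by
          have q1 : 1 ≤ √n := Real.one_le_sqrt.mpr h1n
          have q2 : √n ≤ √(n + 1) := Real.sqrt_le_sqrt (by linarith)
          have q3 : √n * √n = n := Real.mul_self_sqrt (by linarith)
          have q4 : √(n + 1) * √(n + 1) = n + 1 := Real.mul_self_sqrt (by linarith)
          have q5 : √(n + 1) ≤ √n + 1 := by nlinarith
          rw [show 1 / n = 1 / (√n * √n) by rw [q3]]
          rw [div_add_div _ _ (by positivity) (by positivity),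
            div_le_div_iff₀ (by positivity) (by positivity)]
          have h6 : √n * √(n + 1) ≤ √n * √n + √(n + 1) := by nlinarith
          nlinarith [mul_le_mul_of_nonneg_left h6 (show (0 : ℝ) ≤ √n by positivity)]
        have := mul_le_mul_of_nonneg_left hs1 hβ
        simpa only [mul_add, mul_one_div] using this
      have hBn : β / n ≤ B / n := by gcongr
      have hγB : M.discount * (B / n) ≤ B / n :=
        mul_le_of_le_one_left (by positivity) M.discount.2.2.le
      rw [mul_add] at ht'
      have e2 : 2 * B / n = B / n + B / n := by ring
      rw [e2]
      linarith
    · have hn' : ∀ z, d'.next x b z = d.next x b z := fun z => by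
        rw [hd', update_next, if_neg fun h => hxb ⟨h.1, h.2.1, h.2.2.1⟩, add_zero]
      have hc' : d'.count x b = d.count x b := by
        rw [hd', update_count, if_neg hxb, add_zero]
      have hr' : d'.rewardSum x b = d.rewardSum x b := by
        rw [hd', update_rewardSum, if_neg hxb, add_zero]
      have e : bellmanOp (M.discount : ℝ) (d'.bonusReward M.discount β) d'.empTrans
          (d.optimisticQ M.discount β) x b = d.optimisticQ M.discount β x b := by
        conv_rhs => rw [← bellmanOp_optimisticQ]
        simp only [bellmanOp, bonusReward, empTrans, hn', hc', hr']
      rw [e]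
      have := mul_nonneg hγ1.le hc0
      linarith
  refine ciSup_le fun b => ?_
  have := le_add_of_le_bellmanOp hγ0 M.discount.2.2 d'.empTrans_nonneg d'.empTrans_sum_le hc0
    key (fun s a => (congrFun (congrFun (d'.bellmanOp_optimisticQ M.discount β) s) a).le) y b
  exact this.trans (add_le_add_left (d'.optimisticQ_le_optimisticV M.discount β y b) c)

end Memory

/-! ### One-step inequalities and the potential -/

/-- The relative error of the transition counts is absorbed into the discount, at the price of half
of the margin 1 - γ. -/
theorem discount_mul_le (γ : Set.Ico (0 : ℝ) 1) :
    (γ : ℝ) * (1 + (1 - γ) / 2) ≤ 1 - (1 - γ) / 2 := by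
  nlinarith [sq_nonneg (1 - (γ : ℝ))]

namespace Memory

variable {S A : Type*} [Fintype S] [Fintype A]

/-- The recorded successors of every state-action pair are typical for the MDP `M`: the empirical
means of the optimal value are accurate, and no transition is strongly overrepresented. -/
structure Accurate (d : Memory S A) (M : FinMDP S A) (β ℓ : ℝ) : Prop where
  lower : ∀ s a, d.count s a * ∑ y, M.trans s a y * M.optValue y -
    ∑ y, (d.next s a y : ℝ) * M.optValue y ≤ √(d.count s a) * β
  upper : ∀ s a, ∑ y, (d.next s a y : ℝ) * M.optValue y -
    d.count s a * ∑ y, M.trans s a y * M.optValue y ≤ √(d.count s a) * (2 * β)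
  next_le : ∀ s a y, (d.next s a y : ℝ) ≤
    (1 + (1 - M.discount) / 2) * (M.trans s a y * d.count s a) + 2 * ℓ / (1 - M.discount)

variable {M : FinMDP S A} {β ℓ : ℝ} {d : Memory S A}

/-- The estimate is made successor by successor, so `f` may depend on the recorded data; the price
is the factor |S| in the additive term. -/
theorem Accurate.sum_next_mul_le (hd : d.Accurate M β ℓ) (hℓ : 0 ≤ ℓ) {f : S → ℝ} {B : ℝ}
    (hf0 : ∀ y, 0 ≤ f y) (hf : ∀ y, f y ≤ B) {s : S} {a : A} (h0 : d.count s a ≠ 0) :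
    (∑ y, (d.next s a y : ℝ) * f y) / d.count s a ≤
      (1 + (1 - M.discount) / 2) * ∑ y, M.trans s a y * f y +
        2 * Fintype.card S * ℓ * B / (d.count s a * (1 - M.discount)) := by
  have hγ1 : (0 : ℝ) < 1 - M.discount := sub_pos.mpr M.discount.2.2
  have hn : (0 : ℝ) < d.count s a := by exact_mod_cast Nat.pos_of_ne_zero h0
  rw [div_le_iff₀ hn]
  calc ∑ y, (d.next s a y : ℝ) * f y
      ≤ ∑ y, ((1 + (1 - M.discount) / 2) * (M.trans s a y * d.count s a) * f y +
          2 * ℓ / (1 - M.discount) * B) := by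
        refine Finset.sum_le_sum fun y _ => ?_
        refine (mul_le_mul_of_nonneg_right (hd.next_le s a y) (hf0 y)).trans ?_
        rw [add_mul]
        gcongr
        exact hf y
    _ = _ := by
        rw [Finset.sum_add_distrib, Finset.sum_const, Finset.card_univ, nsmul_eq_mul, add_mul,
          mul_assoc, Finset.sum_mul, Finset.mul_sum]
        congr 1
        · exact Finset.sum_congr rfl fun y _ => by ring
        · field_simp

/-- The greedy policy for the optimistic Q-function. -/
def greedyPolicy (M : FinMDP S A) (greedy : (S → A → ℝ) → S → A) (β : ℝ) (d : Memory S A) :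
    S → A := greedy (d.optimisticQ M.discount β)

/-- The potential of the analysis: the larger one of the excess of the sub-optimality gap over `κ`
and the excess of the optimistic value over `6 / (1 - γ)`. -/
def potential (M : FinMDP S A) (greedy : (S → A → ℝ) → S → A) (β κ : ℝ) (d : Memory S A) (s : S) :
    ℝ :=
  max 0 (max (d.optimisticV M.discount β s -
      M.value (FinMDP.det (greedyPolicy M greedy β d)) s - κ)
    (d.optimisticV M.discount β s - 6 / (1 - M.discount)))

theorem potential_nonneg (greedy : (S → A → ℝ) → S → A) (κ : ℝ) (s : S) :
    0 ≤ d.potential M greedy β κ s := le_max_left _ _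

variable [Nonempty A]

theorem optimisticV_eq {greedy : (S → A → ℝ) → S → A} (hg : IsGreedyRule greedy) (s : S) :
    d.optimisticV M.discount β s =
      d.optimisticQ M.discount β s (greedyPolicy M greedy β d s) :=
  le_antisymm (ciSup_le fun a => hg _ s a) (d.optimisticQ_le_optimisticV _ _ _ _)

/-- One step of the optimistic values along MBIE-EB, from a pair that has been tried often. -/
theorem optimisticV_le_step {greedy : (S → A → ℝ) → S → A} (hg : IsGreedyRule greedy)
    (hr : d.RewardsOf M) (hd : d.Accurate M β ℓ) (hβ : 0 ≤ β) (hℓ : 0 ≤ ℓ) (m : ℕ) {s : S} {a : A}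
    (ha : a = greedyPolicy M greedy β d s) (h0 : d.count s a ≠ 0)
    (h1 : β ^ 2 ≤ d.count s a)
    (h2 : (2 + 2 * Fintype.card S * ℓ) * ((1 + β) / (1 - M.discount)) ≤
      d.count s a * (1 - M.discount)) :
    d.optimisticV M.discount β s ≤ 3 + (1 - (1 - M.discount) / 2) * ∑ y, M.trans s a y *
      (d.update m s a (M.reward s a) y).optimisticV M.discount β y := by
  have hγ0 := M.discount.2.1
  have hγ1 : (0 : ℝ) < 1 - M.discount := sub_pos.mpr M.discount.2.2
  have hn : (0 : ℝ) < d.count s a := by exact_mod_cast Nat.pos_of_ne_zero h0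
  set B := (1 + β) / (1 - (M.discount : ℝ)) with hB
  have hB0 : 0 ≤ B := by positivity
  set n : ℝ := (d.count s a : ℝ)
  set x : ℝ := 1 - (M.discount : ℝ) with hx
  have e := hd.sum_next_mul_le hℓ (optimisticV_nonneg hr hβ) (optimisticV_le hr hβ) h0
  have hT : ∑ y, M.trans s a y * d.optimisticV M.discount β y ≤ ∑ y, M.trans s a y *
      (d.update m s a (M.reward s a) y).optimisticV M.discount β y + 2 * B / (n * x) := by
    calc _ ≤ ∑ y, (M.trans s a y *
        (d.update m s a (M.reward s a) y).optimisticV M.discount β y +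
          M.trans s a y * (2 * B / (n * x))) := by
          refine Finset.sum_le_sum fun y _ => ?_
          rw [← mul_add]
          exact mul_le_mul_of_nonneg_left (optimisticV_le_update hr hβ m h0 y y)
            (M.trans_nonneg _ _ _)
      _ = _ := by rw [Finset.sum_add_distrib, ← Finset.sum_mul, M.trans_sum, one_mul]
  set T := ∑ y, M.trans s a y * d.optimisticV M.discount β y
  set T' := ∑ y, M.trans s a y *
      (d.update m s a (M.reward s a) y).optimisticV M.discount β y
  have hT'0 : 0 ≤ T' := Finset.sum_nonneg fun y _ => mul_nonneg (M.trans_nonneg _ _ _)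
    (optimisticV_nonneg (hr.update m s a y) hβ y)
  -- The constant 3 is made up of one for the reward, one for the bonus and one for the two errors
  -- in `e5`.
  have hβn : β / √n ≤ 1 := div_le_one_of_le₀ (Real.le_sqrt_of_sq_le h1) (by positivity)
  rw [optimisticV_eq hg, ← ha, optimisticQ_eq hr h0]
  have hR := M.reward_le_one s a
  have e1 := mul_le_mul_of_nonneg_left e hγ0
  have e2 : (M.discount : ℝ) * (1 + x / 2) ≤ 1 - x / 2 := discount_mul_le M.discount
  have e3 : (M.discount : ℝ) * ((1 + x / 2) * T) ≤ (1 - x / 2) * T' + 2 * B / (n * x) := by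
    have hc : 0 ≤ 2 * B / (n * x) := by positivity
    calc (M.discount : ℝ) * ((1 + x / 2) * T) = (M.discount * (1 + x / 2)) * T := by ring
      _ ≤ (M.discount * (1 + x / 2)) * (T' + 2 * B / (n * x)) := by gcongr
      _ ≤ (1 - x / 2) * (T' + 2 * B / (n * x)) := by gcongr
      _ ≤ _ := by nlinarith
  have e4 : (M.discount : ℝ) * (2 * (Fintype.card S : ℝ) * ℓ * B / (n * x)) ≤
      2 * (Fintype.card S : ℝ) * ℓ * B / (n * x) :=
    mul_le_of_le_one_left (by positivity) M.discount.2.2.le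
  have e5 : 2 * (Fintype.card S : ℝ) * ℓ * B / (n * x) + 2 * B / (n * x) ≤ 1 := by
    rw [← add_div, div_le_one (by positivity)]
    linarith
  rw [mul_add] at e1
  linarith

/-- One step of the gap between the optimistic value and the value of the policy, from a pair
that has been tried often. -/
theorem optimisticV_sub_value_le_step {greedy : (S → A → ℝ) → S → A} (hg : IsGreedyRule greedy)
    (hr : d.RewardsOf M) (hd : d.Accurate M β ℓ) (hβ : 0 ≤ β) (hℓ : 0 ≤ ℓ) {s : S} {a : A}
    (ha : a = greedyPolicy M greedy β d s) (h0 : d.count s a ≠ 0) :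
    d.optimisticV M.discount β s - M.value (FinMDP.det (greedyPolicy M greedy β d)) s ≤
      3 * β / √(d.count s a) + 2 * Fintype.card S * ℓ * ((1 + β) / (1 - M.discount)) /
        (d.count s a * (1 - M.discount)) +
      (1 - (1 - M.discount) / 2) * ∑ y, M.trans s a y * (d.optimisticV M.discount β y -
        M.value (FinMDP.det (greedyPolicy M greedy β d)) y) := by
  have hγ0 := M.discount.2.1
  have hγ1 : (0 : ℝ) < 1 - M.discount := sub_pos.mpr M.discount.2.2
  have hn : (0 : ℝ) < d.count s a := by exact_mod_cast Nat.pos_of_ne_zero h0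
  have hopt := optValue_le_optimisticV hr hd.lower hβ
  set π := greedyPolicy M greedy β d with hπ
  set B := (1 + β) / (1 - (M.discount : ℝ)) with hB
  have hB0 : 0 ≤ B := by positivity
  -- The empirical mean of Ṽ is split into that of V*, controlled by `upper`, and that of Ṽ - V* ≥
  -- 0, controlled by the counts.
  have e := hd.sum_next_mul_le hℓ
    (f := fun y => d.optimisticV M.discount β y - M.optValue y)
    (fun y => sub_nonneg.mpr (hopt y))
    (B := B) (fun y => by
      have h1 := optimisticV_le hr hβ y
      have h2 := (M.optValue_mem_Icc y).1
      linarith) h0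
  have hup : (∑ y, (d.next s a y : ℝ) * M.optValue y) / d.count s a ≤
      ∑ y, M.trans s a y * M.optValue y + 2 * β / √(d.count s a) := by
    have h1 := hd.upper s a
    have h2 : (∑ y, (d.next s a y : ℝ) * M.optValue y) / d.count s a ≤
      (d.count s a * ∑ y, M.trans s a y * M.optValue y + √(d.count s a) * (2 * β)) /
        d.count s a := by
      gcongr
      linarith
    refine h2.trans (le_of_eq ?_)
    have hs : √(d.count s a : ℝ) ≠ 0 := (Real.sqrt_pos.mpr hn).ne'
    rw [add_div, mul_div_cancel_left₀ _ hn.ne']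
    congr 1
    rw [div_eq_div_iff hn.ne' hs, mul_right_comm, Real.mul_self_sqrt hn.le, mul_comm]
  have hV := M.value_det π s
  rw [← ha] at hV
  have hsplit : (∑ y, (d.next s a y : ℝ) * d.optimisticV M.discount β y) / d.count s a =
      (∑ y, (d.next s a y : ℝ) * M.optValue y) / d.count s a +
      (∑ y, (d.next s a y : ℝ) * (d.optimisticV M.discount β y - M.optValue y)) /
        d.count s a := by
    rw [← add_div, ← Finset.sum_add_distrib]
    congr 1
    exact Finset.sum_congr rfl fun y _ => by ring
  have hD : ∑ y, M.trans s a y * (d.optimisticV M.discount β y - M.optValue y) ≤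
      ∑ y, M.trans s a y * (d.optimisticV M.discount β y - M.value (FinMDP.det π) y) :=
    Finset.sum_le_sum fun y _ => mul_le_mul_of_nonneg_left
      (sub_le_sub_left (M.value_det_le_optValue π y) _) (M.trans_nonneg _ _ _)
  have hDelta0 : 0 ≤
      ∑ y, M.trans s a y * (d.optimisticV M.discount β y - M.value (FinMDP.det π) y) :=
    Finset.sum_nonneg fun y _ => mul_nonneg (M.trans_nonneg _ _ _)
      (sub_nonneg.mpr ((M.value_det_le_optValue π y).trans (hopt y)))
  rw [optimisticV_eq hg, ← hπ, ← ha, optimisticQ_eq hr h0, hV, hsplit]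
  have hsub : ∀ f g : S → ℝ, ∑ y, M.trans s a y * (f y - g y) =
      ∑ y, M.trans s a y * f y - ∑ y, M.trans s a y * g y := fun f g => by
    simp only [mul_sub, Finset.sum_sub_distrib]
  rw [hsub] at e hDelta0 ⊢
  rw [hsub, hsub] at hD
  set TV := ∑ y, M.trans s a y * M.optValue y
  set TU := ∑ y, M.trans s a y * d.optimisticV M.discount β y
  set TP := ∑ y, M.trans s a y * M.value (FinMDP.det π) y
  set x : ℝ := 1 - (M.discount : ℝ) with hx
  set c := 2 * Fintype.card S * ℓ * B / (d.count s a * x)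
  have hc0 : 0 ≤ c := by positivity
  set b := 2 * β / √(d.count s a : ℝ) with hb
  have hb0 : 0 ≤ b := by positivity
  have hb3 : 3 * β / √(d.count s a : ℝ) = β / √(d.count s a : ℝ) + b := by
    rw [hb]
    ring
  have e2 : (M.discount : ℝ) * (1 + x / 2) ≤ 1 - x / 2 := discount_mul_le M.discount
  have e3 := mul_le_mul_of_nonneg_right e2 hDelta0
  have e4 := mul_le_mul_of_nonneg_left (add_le_add hup e) hγ0
  have e5 : M.discount * (b + c) ≤ b + c :=
    mul_le_of_le_one_left (by positivity) M.discount.2.2.le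
  -- Since the value of the policy is below V*, the relative error of Ṽ - V* is at most that of the
  -- gap itself, which the recursion can absorb.
  have e6 : M.discount * (x / 2 * (TU - TV)) ≤ M.discount * (x / 2 * (TU - TP)) := by
    gcongr
  rw [hb3]
  nlinarith

theorem potential_le (hr : d.RewardsOf M) (hβ : 0 ≤ β) (greedy : (S → A → ℝ) → S → A) {κ : ℝ}
    (hκ : 0 ≤ κ) (s : S) : d.potential M greedy β κ s ≤ (1 + β) / (1 - M.discount) := by
  have hγ1 : (0 : ℝ) < 1 - M.discount := sub_pos.mpr M.discount.2.2
  have h1 := optimisticV_le hr hβ s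
  have h2 := M.value_det_nonneg (greedyPolicy M greedy β d) s
  have h3 : 0 ≤ 6 / (1 - (M.discount : ℝ)) := by positivity
  refine max_le (by positivity) (max_le ?_ ?_) <;> linarith

/-- One step of the potential along MBIE-EB. -/
theorem potential_le_step {greedy : (S → A → ℝ) → S → A} (hg : IsGreedyRule greedy)
    (hr : d.RewardsOf M) (hd : d.Accurate M β ℓ) (hβ : 0 ≤ β) (hℓ : 0 ≤ ℓ) {κ : ℝ} (hκ : 0 ≤ κ)
    {m n₁ : ℕ} (hn₁ : 0 < n₁) (hn₁m : n₁ ≤ m) (hm : ∀ s a, d.count s a ≤ m)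
    (h1 : β ^ 2 ≤ n₁)
    (h2 : (2 + 2 * Fintype.card S * ℓ) * ((1 + β) / (1 - M.discount)) ≤
      n₁ * (1 - M.discount))
    (h3 : 3 * β / √m + 2 * Fintype.card S * ℓ * ((1 + β) / (1 - M.discount)) /
        (m * (1 - M.discount)) ≤ κ * (1 - M.discount) / 2) {s : S} {a : A}
    (ha : a = greedyPolicy M greedy β d s) :
    d.potential M greedy β κ s ≤
      ((if d.count s a < m then 6 / (1 - (M.discount : ℝ)) else 0) +
        (if d.count s a < n₁ then (1 + β) / (1 - (M.discount : ℝ)) else 0)) +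
      (1 - (1 - M.discount) / 2) * ∑ y, M.trans s a y *
        (d.update m s a (M.reward s a) y).potential M greedy β κ y := by
  have hγ0 := M.discount.2.1
  have hγ1 : (0 : ℝ) < 1 - M.discount := sub_pos.mpr M.discount.2.2
  have hx2 : (0 : ℝ) ≤ 1 - (1 - M.discount) / 2 := by linarith
  have hB0 : 0 ≤ (1 + β) / (1 - (M.discount : ℝ)) := by positivity
  have hc0 : 0 ≤ 6 / (1 - (M.discount : ℝ)) := by positivity
  have hE0 : 0 ≤ (1 - (1 - (M.discount : ℝ)) / 2) * ∑ y, M.trans s a y *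
        (d.update m s a (M.reward s a) y).potential M greedy β κ y :=
    mul_nonneg hx2 (Finset.sum_nonneg fun y _ => mul_nonneg (M.trans_nonneg _ _ _)
      (potential_nonneg _ _ _))
  -- Below `n₁` experiences the whole potential is paid for by its upper bound.
  by_cases hlow : d.count s a < n₁
  · rw [if_pos (hlow.trans_le hn₁m), if_pos hlow]
    have := potential_le hr hβ greedy hκ s
    linarith
  have hge : n₁ ≤ d.count s a := not_lt.mp hlow
  have hge' : (n₁ : ℝ) ≤ d.count s a := by exact_mod_cast hge
  have h0 : d.count s a ≠ 0 := by omega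
  have hav : ∀ {f g : S → ℝ} {c : ℝ}, (∀ y, f y - c ≤ g y) →
      ∑ y, M.trans s a y * f y ≤ ∑ y, M.trans s a y * g y + c := by
    intro f g c h
    calc ∑ y, M.trans s a y * f y ≤ ∑ y, (M.trans s a y * g y + M.trans s a y * c) := by
          refine Finset.sum_le_sum fun y _ => ?_
          rw [← mul_add]
          exact mul_le_mul_of_nonneg_left (by linarith [h y]) (M.trans_nonneg _ _ _)
      _ = _ := by rw [Finset.sum_add_distrib, ← Finset.sum_mul, M.trans_sum, one_mul]
  have hF := optimisticV_le_step hg hr hd hβ hℓ m ha h0 (h1.trans hge')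
    (h2.trans (mul_le_mul_of_nonneg_right hge' hγ1.le))
  have hF' : d.optimisticV M.discount β s - 6 / (1 - M.discount) ≤
      (1 - (1 - M.discount) / 2) * ∑ y, M.trans s a y *
        (d.update m s a (M.reward s a) y).potential M greedy β κ y := by
    have := mul_le_mul_of_nonneg_left (hav
      (f := fun y => (d.update m s a (M.reward s a) y).optimisticV M.discount β y)
      (g := fun y => (d.update m s a (M.reward s a) y).potential M greedy β κ y)
      (c := 6 / (1 - M.discount)) fun y =>
        (le_max_right _ _).trans (le_max_right _ _)) hx2
    -- 6/(1 - γ) is the fixed point of v ↦ 3 + (1 - (1 - γ)/2)v, so the excess over it contracts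
    -- without an additive constant.
    have e : (1 - (1 - (M.discount : ℝ)) / 2) * (6 / (1 - M.discount)) =
        6 / (1 - M.discount) - 3 := by
      field_simp
      ring
    rw [mul_add, e] at this
    linarith
  rw [if_neg hlow, add_zero]
  -- Between `n₁` and `m` the gap is at most Ṽ, that is, 6/(1 - γ) plus an excess that contracts. At
  -- `m` the update is void and the policy stays the same; by `h3` the one-step error is at most κ(1
  -- - γ)/2, just what subtracting κ from the gap compensates.
  by_cases hmid : d.count s a < m
  · rw [if_pos hmid]
    have hv := M.value_det_nonneg (greedyPolicy M greedy β d) s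
    refine max_le (by linarith) (max_le (by linarith) (by linarith))
  · have hcm : d.count s a = m := le_antisymm (hm s a) (not_lt.mp hmid)
    rw [if_neg hmid, zero_add]
    refine max_le hE0 (max_le ?_ hF')
    have hΔ := optimisticV_sub_value_le_step hg hr hd hβ hℓ ha h0
    rw [hcm] at hΔ
    simp only [update_of_le hcm.ge]
    have := mul_le_mul_of_nonneg_left (hav
      (f := fun y => d.optimisticV M.discount β y -
        M.value (FinMDP.det (greedyPolicy M greedy β d)) y)
      (g := fun y => d.potential M greedy β κ y)
      (c := κ) fun y => (le_max_left _ _).trans (le_max_right _ _)) hx2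
    rw [mul_add] at this
    linarith

end Memory

/-! ### Concentration along a run -/

open MeasureTheory in
theorem measure_iUnion_le_card_mul {Ω ι : Type*} [MeasurableSpace Ω] {μ : Measure Ω} [Fintype ι] {E : ι → Set Ω} {r : ℝ}
    (h : ∀ i, μ (E i) ≤ ENNReal.ofReal r) :
    μ (⋃ i, E i) ≤ ENNReal.ofReal (Fintype.card ι * r) := by
  refine (measure_iUnion_fintype_le μ E).trans ((Finset.sum_le_sum fun i _ => h i).trans ?_)
  rw [Finset.sum_const, Finset.card_univ, nsmul_eq_mul, ENNReal.ofReal_mul (Nat.cast_nonneg _),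
    ENNReal.ofReal_natCast]

namespace MBIEEB

open MeasureTheory

variable {S A : Type*} [Fintype S] [Fintype A] {M : FinMDP S A} {greedy : (S → A → ℝ) → S → A}
  {β : ℝ} {m : ℕ} {Ω : Type*} [MeasurableSpace Ω] {μ : Measure Ω} [IsProbabilityMeasure μ]
  {X : ℕ → Ω → S}

/-- Hoeffding's bound for a fixed count, at all times at once. The parameter θ maximises θ√n v -
nθ²(c - b)²/8. -/
theorem IsRun.measure_exists_sqrt_mul_le (hX : IsRun M greedy β m μ X) {f : S → ℝ} {b c : ℝ}
    (hbc : b < c) (hf : ∀ y, f y ∈ Set.Icc b c) (s : S) (a : A) {n : ℕ} (hn : 0 < n) (v : ℝ)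
    (hv : 0 ≤ v) :
    μ {ω | ∃ t, (memory M greedy β m (fun i => X i ω) t).count s a = n ∧
      √n * v ≤ ∑ y, (memory M greedy β m (fun i => X i ω) t).next s a y * f y -
        n * ∑ y, M.trans s a y * f y} ≤ ENNReal.ofReal (Real.exp (-(2 * (v / (c - b)) ^ 2))) := by
  have hn' : (0 : ℝ) < n := by exact_mod_cast hn
  have hR : 0 < c - b := sub_pos.mpr hbc
  have hsq : 0 < √(n : ℝ) := Real.sqrt_pos.mpr hn'
  have hss : √(n : ℝ) ^ 2 = n := Real.sq_sqrt hn'.le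
  set θ := 4 * v / (√n * (c - b) ^ 2) with hθ
  refine (measure_mono ?_).trans (hX.measure_exists_le_sum_next s a
    (fun y => θ * (f y - ∑ z, M.trans s a z * f z) - θ ^ 2 * (c - b) ^ 2 / 8)
    (sum_mul_exp_le_one_of_mem_Icc (M.trans_nonneg s a) (M.trans_sum s a) hf θ) _)
  rintro ω ⟨t, h1, h2⟩
  refine ⟨t, ?_⟩
  set d := memory M greedy β m (fun i => X i ω) t
  have e : ∑ y, (d.next s a y : ℝ) * (θ * (f y - ∑ z, M.trans s a z * f z) -
      θ ^ 2 * (c - b) ^ 2 / 8) = θ * (∑ y, (d.next s a y : ℝ) * f y -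
        n * ∑ y, M.trans s a y * f y) - n * (θ ^ 2 * (c - b) ^ 2 / 8) := by
    rw [← h1, ← d.sum_next, Finset.sum_mul, Finset.sum_mul, ← Finset.sum_sub_distrib,
      Finset.mul_sum, ← Finset.sum_sub_distrib]
    exact Finset.sum_congr rfl fun y _ => by ring
  rw [e]
  have hθ0 : 0 ≤ θ := by positivity
  have h3 := mul_le_mul_of_nonneg_left h2 hθ0
  have e2 : θ * (√n * v) - n * (θ ^ 2 * (c - b) ^ 2 / 8) = 2 * (v / (c - b)) ^ 2 := by
    rw [← hss, hθ, Real.sqrt_sq hsq.le]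
    field_simp
    ring
  linarith

/-- A Chernoff bound with θ = (1 - γ)/2, where exp θ - 1 ≤ θ(1 + θ). The compensator is proportional
to the count, so no union over counts is needed. -/
theorem IsRun.measure_exists_lt_next (hX : IsRun M greedy β m μ X) (s : S) (a : A) (y : S)
    (ℓ : ℝ) :
    μ {ω | ∃ t, (1 + (1 - M.discount) / 2) * (M.trans s a y *
        (memory M greedy β m (fun i => X i ω) t).count s a) + 2 * ℓ / (1 - M.discount) <
      ((memory M greedy β m (fun i => X i ω) t).next s a y : ℝ)} ≤
      ENNReal.ofReal (Real.exp (-ℓ)) := by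
  classical
  have hγ0 := M.discount.2.1
  have hγ1 : (0 : ℝ) < 1 - M.discount := sub_pos.mpr M.discount.2.2
  set θ : ℝ := (1 - M.discount) / 2 with hθ
  have hθ0 : 0 < θ := by positivity
  refine (measure_mono ?_).trans (hX.measure_exists_le_sum_next s a _
    (sum_mul_exp_indicator_le_one (M.trans_sum s a) y θ) _)
  rintro ω ⟨t, h⟩
  refine ⟨t, ?_⟩
  set d := memory M greedy β m (fun i => X i ω) t
  have e : ∑ z, (d.next s a z : ℝ) * (θ * (if z = y then 1 else 0) -
      (Real.exp θ - 1) * M.trans s a y) =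
      θ * d.next s a y - (Real.exp θ - 1) * (M.trans s a y * d.count s a) := by
    simp only [mul_sub, Finset.sum_sub_distrib, ← Finset.sum_mul, d.sum_next]
    simp
    ring
  rw [e]
  have h1 : Real.exp θ - 1 ≤ θ * (1 + θ) := by
    have := Real.abs_exp_sub_one_sub_id_le (x := θ) (by rw [abs_of_pos hθ0]; linarith)
    have := (abs_le.mp this).2
    nlinarith
  have h2 : 0 ≤ M.trans s a y * d.count s a :=
    mul_nonneg (M.trans_nonneg _ _ _) (Nat.cast_nonneg _)
  have h3 := mul_le_mul_of_nonneg_right h1 h2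
  have h4 := mul_lt_mul_of_pos_left h hθ0
  have e2 : θ * (2 * ℓ / (1 - M.discount)) = ℓ := by
    rw [hθ]
    field_simp
  rw [mul_add, e2] at h4
  linarith

/-- With high probability the memory of MBIE-EB is accurate at all times. -/
theorem IsRun.measure_exists_not_accurate [Nonempty A] (hX : IsRun M greedy β m μ X)
    (hβ : 0 ≤ β) (ℓ : ℝ) :
    μ {ω | ∃ t, ¬ (memory M greedy β m (fun i => X i ω) t).Accurate M β ℓ} ≤
      ENNReal.ofReal ((Fintype.card S * Fintype.card A * m : ℝ) *
          (Real.exp (-(2 * (β * (1 - M.discount)) ^ 2)) +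
            Real.exp (-(2 * (2 * β * (1 - M.discount)) ^ 2))) +
        (Fintype.card S * Fintype.card A * Fintype.card S : ℝ) * Real.exp (-ℓ)) := by
  have hγ1 : (0 : ℝ) < 1 - M.discount := sub_pos.mpr M.discount.2.2
  have hV := M.optValue_mem_Icc
  -- The index `k : Fin m` stands for the count k + 1; a count of zero is trivial. Using -V* turns a
  -- lower deviation into an upper one.
  let E₁ : S × A × Fin m → Set Ω := fun p =>
    {ω | ∃ t, (memory M greedy β m (fun i => X i ω) t).count p.1 p.2.1 = (p.2.2 + 1 : ℕ) ∧
      √(p.2.2 + 1 : ℕ) * β ≤ ∑ y, (memory M greedy β m (fun i => X i ω) t).next p.1 p.2.1 y *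
        (-M.optValue y) - (p.2.2 + 1 : ℕ) * ∑ y, M.trans p.1 p.2.1 y * (-M.optValue y)}
  let E₂ : S × A × Fin m → Set Ω := fun p =>
    {ω | ∃ t, (memory M greedy β m (fun i => X i ω) t).count p.1 p.2.1 = (p.2.2 + 1 : ℕ) ∧
      √(p.2.2 + 1 : ℕ) * (2 * β) ≤
        ∑ y, (memory M greedy β m (fun i => X i ω) t).next p.1 p.2.1 y * M.optValue y -
          (p.2.2 + 1 : ℕ) * ∑ y, M.trans p.1 p.2.1 y * M.optValue y}
  let E₃ : S × A × S → Set Ω := fun p =>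
    {ω | ∃ t, (1 + (1 - M.discount) / 2) * (M.trans p.1 p.2.1 p.2.2 *
        (memory M greedy β m (fun i => X i ω) t).count p.1 p.2.1) + 2 * ℓ / (1 - M.discount) <
      ((memory M greedy β m (fun i => X i ω) t).next p.1 p.2.1 p.2.2 : ℝ)}
  have hE₁ : μ (⋃ p, E₁ p) ≤ ENNReal.ofReal (Fintype.card (S × A × Fin m) *
      Real.exp (-(2 * (β * (1 - M.discount)) ^ 2))) := by
    refine measure_iUnion_le_card_mul fun p => ?_
    have := hX.measure_exists_sqrt_mul_le (f := fun y => -M.optValue y)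
      (b := -(1 / (1 - (M.discount : ℝ)))) (c := 0) (by simpa using hγ1)
      (fun y => ⟨neg_le_neg (hV y).2, neg_nonpos.mpr (hV y).1⟩) p.1 p.2.1
      (Nat.succ_pos p.2.2) β hβ
    rwa [zero_sub, neg_neg, div_div_eq_mul_div, div_one] at this
  have hE₂ : μ (⋃ p, E₂ p) ≤ ENNReal.ofReal (Fintype.card (S × A × Fin m) *
      Real.exp (-(2 * (2 * β * (1 - M.discount)) ^ 2))) := by
    refine measure_iUnion_le_card_mul fun p => ?_
    have := hX.measure_exists_sqrt_mul_le (f := M.optValue)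
      (b := 0) (c := 1 / (1 - (M.discount : ℝ))) (by simpa using hγ1) hV p.1 p.2.1
      (Nat.succ_pos p.2.2) (2 * β) (by positivity)
    rwa [sub_zero, div_div_eq_mul_div, div_one] at this
  have hE₃ : μ (⋃ p, E₃ p) ≤ ENNReal.ofReal (Fintype.card (S × A × S) * Real.exp (-ℓ)) :=
    measure_iUnion_le_card_mul fun p => hX.measure_exists_lt_next p.1 p.2.1 p.2.2 ℓ
  have hsub : {ω | ∃ t, ¬ (memory M greedy β m (fun i => X i ω) t).Accurate M β ℓ} ⊆
      ((⋃ p, E₁ p) ∪ ⋃ p, E₂ p) ∪ ⋃ p, E₃ p := by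
    rintro ω ⟨t, ht⟩
    by_contra hω
    simp only [Set.mem_union, Set.mem_iUnion, not_or, not_exists] at hω
    obtain ⟨⟨h1, h2⟩, h3⟩ := hω
    set d := memory M greedy β m (fun i => X i ω) t with hd
    have hcount : ∀ s a, d.count s a ≠ 0 → ∃ k : Fin m, d.count s a = (k + 1 : ℕ) := by
      intro s a h0
      have := memory_count_le M greedy β m (fun i => X i ω) t s a
      rw [← hd] at this
      exact ⟨⟨d.count s a - 1, by omega⟩, by simp only; omega⟩
    have hzero : ∀ s a, d.count s a = 0 → ∀ f : S → ℝ,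
        ∑ y, (d.next s a y : ℝ) * f y = 0 := by
      intro s a h0 f
      refine Finset.sum_eq_zero fun y _ => ?_
      have : d.next s a y = 0 := (Finset.sum_eq_zero_iff.mp h0) y (Finset.mem_univ _)
      simp [this]
    refine ht ⟨fun s a => ?_, fun s a => ?_, fun s a y => ?_⟩
    · by_cases h0 : d.count s a = 0
      · simp [hzero s a h0, h0]
      · obtain ⟨k, hk⟩ := hcount s a h0
        by_contra! hcon
        refine h1 (s, a, k) ⟨t, hk, ?_⟩
        rw [← hd, ← hk]
        simp only [mul_neg, Finset.sum_neg_distrib]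
        linarith
    · by_cases h0 : d.count s a = 0
      · simp [hzero s a h0, h0]
      · obtain ⟨k, hk⟩ := hcount s a h0
        by_contra! hcon
        refine h2 (s, a, k) ⟨t, hk, ?_⟩
        rw [← hd, ← hk]
        exact hcon.le
    · by_contra! hcon
      exact h3 (s, a, y) ⟨t, hcon⟩
  refine (measure_mono hsub).trans ((measure_union_le _ _).trans
    ((add_le_add_left (measure_union_le _ _) _).trans
      ((add_le_add (add_le_add hE₁ hE₂) hE₃).trans (le_of_eq ?_))))
  rw [← ENNReal.ofReal_add (by positivity) (by positivity),
    ← ENNReal.ofReal_add (by positivity) (by positivity)]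
  congr 1
  simp only [Fintype.card_prod, Fintype.card_fin]
  push_cast
  ring

/-- The conditional expectation, given the states up to time `t`, of a function of the states up
to time `t + 1`. -/
def stepMean (M : FinMDP S A) (greedy : (S → A → ℝ) → S → A) (β : ℝ) (m : ℕ)
    (P : ℕ → (ℕ → S) → ℝ) (t : ℕ) (x : ℕ → S) : ℝ :=
  ∑ y, M.trans (x t) (action M greedy β m x t) y * P (t + 1) (Function.update x (t + 1) y)

theorem stepMean_congr {P : ℕ → (ℕ → S) → ℝ}
    (hP : ∀ t x y, (∀ i ≤ t, x i = y i) → P t x = P t y) (t : ℕ) {x y : ℕ → S}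
    (h : ∀ i ≤ t, x i = y i) :
    stepMean M greedy β m P t x = stepMean M greedy β m P t y := by
  simp only [stepMean, action_congr M greedy β m t h, h t le_rfl]
  refine Finset.sum_congr rfl fun z _ => ?_
  rw [hP (t + 1) _ (Function.update y (t + 1) z)]
  intro i hi
  rcases Nat.lt_or_ge i (t + 1) with hlt | hge
  · rw [Function.update_of_ne (by omega), Function.update_of_ne (by omega), h i (by omega)]
  · obtain rfl : i = t + 1 := by omega
    simp

/-- The sum of the conditional expectations of a bounded nonnegative process is, with high
probability, not much larger than the sum of the process. -/
theorem IsRun.measure_exists_le_sum_stepMean (hX : IsRun M greedy β m μ X)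
    {P : ℕ → (ℕ → S) → ℝ} (hP : ∀ t x y, (∀ i ≤ t, x i = y i) → P t x = P t y)
    {B θ : ℝ} (hP0 : ∀ t x, 0 ≤ P t x) (hPB : ∀ t x, P t x ≤ B) (hθ : 0 ≤ θ) (hθB : θ * B ≤ 1)
    (u : ℝ) :
    μ {ω | ∃ t, u ≤ ∑ i ∈ Finset.range t,
      (θ * (1 - θ * B) * stepMean M greedy β m P i (fun j => X j ω) -
        θ * P (i + 1) (fun j => X j ω))} ≤ ENNReal.ofReal (Real.exp (-u)) := by
  refine hX.measure_exists_le_sum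
    (fun i x => θ * (1 - θ * B) * stepMean M greedy β m P i x - θ * P (i + 1) x)
    (fun t x y h => ?_) (fun t x => ?_) u
  · simp only [hP (t + 1) x y h, stepMean_congr hP t fun i hi => h i (by omega)]
  · have h1 : ∀ y, stepMean M greedy β m P t (Function.update x (t + 1) y) =
        stepMean M greedy β m P t x := fun y =>
      stepMean_congr hP t fun i hi => Function.update_of_ne (by omega) _ _
    simp only [h1]
    set E := stepMean M greedy β m P t x with hE
    -- For 0 ≤ z ≤ θB ≤ 1, exp(-z) ≤ 1 - z + z² ≤ 1 - (1 - θB)z. This is affine in the process, so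
    -- it averages to an expression in `E`.
    have h2 : ∀ y, Real.exp (-(θ * P (t + 1) (Function.update x (t + 1) y))) ≤
        1 - θ * (1 - θ * B) * P (t + 1) (Function.update x (t + 1) y) := by
      intro y
      set p := P (t + 1) (Function.update x (t + 1) y)
      have hp0 : 0 ≤ p := hP0 _ _
      have hpB : p ≤ B := hPB _ _
      have hz : θ * p ≤ θ * B := mul_le_mul_of_nonneg_left hpB hθ
      have := Real.abs_exp_sub_one_sub_id_le (x := -(θ * p)) (by
        rw [abs_neg, abs_of_nonneg (mul_nonneg hθ hp0)]
        linarith)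
      have := (abs_le.mp this).2
      nlinarith [mul_le_mul_of_nonneg_left hz (mul_nonneg hθ hp0)]
    calc ∑ y, M.trans (x t) (action M greedy β m x t) y *
          Real.exp (θ * (1 - θ * B) * E - θ * P (t + 1) (Function.update x (t + 1) y))
        ≤ ∑ y, M.trans (x t) (action M greedy β m x t) y * (Real.exp (θ * (1 - θ * B) * E) *
          (1 - θ * (1 - θ * B) * P (t + 1) (Function.update x (t + 1) y))) := by
          refine Finset.sum_le_sum fun y _ => mul_le_mul_of_nonneg_left ?_ (M.trans_nonneg _ _ _)
          rw [sub_eq_add_neg, Real.exp_add]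
          exact mul_le_mul_of_nonneg_left (h2 y) (Real.exp_pos _).le
      _ = Real.exp (θ * (1 - θ * B) * E) * (1 - θ * (1 - θ * B) * E) := by
          generalize Real.exp (θ * (1 - θ * B) * E) = c
          generalize θ * (1 - θ * B) = k
          conv_rhs => rw [← M.trans_sum (x t) (action M greedy β m x t)]
          rw [hE, stepMean, Finset.mul_sum, ← Finset.sum_sub_distrib, Finset.mul_sum]
          exact Finset.sum_congr rfl fun y _ => by ring
      _ ≤ Real.exp (θ * (1 - θ * B) * E) * Real.exp (-(θ * (1 - θ * B) * E)) := by
          gcongr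
          exact Real.one_sub_le_exp_neg _
      _ = 1 := by rw [← Real.exp_add, add_neg_cancel, Real.exp_zero]

end MBIEEB

/-! ### Summing the recursion -/

/-- A discounted recursion for a process, together with a bound on the deviation of its
conditional expectations, bounds its sum. -/
theorem sum_range_le_of_recursion {P E z : ℕ → ℝ} {x B u : ℝ} (hx0 : 0 < x) (hx1 : x ≤ 1)
    (hB : 0 < B) (hu : 0 ≤ u) (hPB : ∀ i, P i ≤ B) (hP0 : ∀ i, 0 ≤ P i) (hE0 : ∀ i, 0 ≤ E i)
    (hrec : ∀ i, P i ≤ z i + (1 - x / 2) * E i) (N : ℕ)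
    (hdev : ∑ i ∈ Finset.range N,
      (x / (4 * B) * (1 - x / (4 * B) * B) * E i - x / (4 * B) * P (i + 1)) ≤ u) :
    ∑ i ∈ Finset.range N, P i ≤
      4 / x * (∑ i ∈ Finset.range N, z i + B + 4 * B * u / x) := by
  have hsum := Finset.sum_le_sum fun i (_ : i ∈ Finset.range N) => hrec i
  rw [Finset.sum_add_distrib, ← Finset.mul_sum] at hsum
  rw [Finset.sum_sub_distrib, ← Finset.mul_sum, ← Finset.mul_sum] at hdev
  have hshift : ∑ i ∈ Finset.range N, P (i + 1) ≤ ∑ i ∈ Finset.range N, P i + B := by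
    have h1 := Finset.sum_range_succ P N
    have h2 := Finset.sum_range_succ' P N
    have h3 := hP0 0
    have h4 := hPB N
    linarith
  have hSE : 0 ≤ ∑ i ∈ Finset.range N, E i := Finset.sum_nonneg fun i _ => hE0 i
  have hSP : 0 ≤ ∑ i ∈ Finset.range N, P i := Finset.sum_nonneg fun i _ => hP0 i
  have hSP' : 0 ≤ ∑ i ∈ Finset.range N, P (i + 1) := Finset.sum_nonneg fun i _ => hP0 _
  set SE := ∑ i ∈ Finset.range N, E i
  set SP := ∑ i ∈ Finset.range N, P i
  set SP' := ∑ i ∈ Finset.range N, P (i + 1)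
  set Z := ∑ i ∈ Finset.range N, z i
  have h1 : (1 - x / 4) * SE ≤ SP' + 4 * B * u / x := by
    have e : x / (4 * B) * (1 - x / (4 * B) * B) * SE - x / (4 * B) * SP' =
        x / (4 * B) * ((1 - x / 4) * SE - SP') := by
      field_simp
    rw [e] at hdev
    have h2 : (1 - x / 4) * SE - SP' ≤ u / (x / (4 * B)) := by
      rw [le_div_iff₀ (by positivity)]
      linarith
    have e2 : u / (x / (4 * B)) = 4 * B * u / x := by
      field_simp
    linarith
  have h2 : (1 - x / 2) * SE ≤ (1 - x / 4) * (SP + B + 4 * B * u / x) := by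
    have h3 : (1 - x / 4) * ((1 - x / 4) * SE) ≤ (1 - x / 4) * (SP + B + 4 * B * u / x) := by
      refine mul_le_mul_of_nonneg_left ?_ (by linarith)
      linarith
    -- 1 - x/2 ≤ (1 - x/4)²: one factor pays for the deviation bound, the other remains as
    -- contraction.
    nlinarith [mul_nonneg (sq_nonneg x) hSE]
  have hW : 0 ≤ 4 * B * u / x := by positivity
  rw [div_mul_eq_mul_div, le_div_iff₀ hx0]
  nlinarith [mul_nonneg hx0.le hW, mul_nonneg hx0.le hB.le]

namespace MBIEEB

open MeasureTheory

variable {S A : Type*} [Fintype S] [Fintype A] [Nonempty A] {M : FinMDP S A}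
  {greedy : (S → A → ℝ) → S → A}
  {β : ℝ} {m : ℕ} {Ω : Type*} [MeasurableSpace Ω] {μ : Measure Ω} [IsProbabilityMeasure μ]
  {X : ℕ → Ω → S}

/-- The sample complexity of MBIE-EB, in terms of the parameters of the analysis: apart from an
event of small probability, all but a bounded number of the policies are near-optimal in the
state where they are used. -/
theorem IsRun.measure_not_forall_near_optimal (hX : IsRun M greedy β m μ X)
    (hg : IsGreedyRule greedy) (hβ : 0 ≤ β) {ℓ : ℝ} (hℓ : 0 ≤ ℓ) {κ : ℝ} (hκ : 0 < κ)
    {n₁ : ℕ} (hn₁ : 0 < n₁) (hn₁m : n₁ ≤ m) (h1 : β ^ 2 ≤ n₁)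
    (h2 : (2 + 2 * Fintype.card S * ℓ) * ((1 + β) / (1 - M.discount)) ≤
      n₁ * (1 - M.discount))
    (h3 : 3 * β / √m + 2 * Fintype.card S * ℓ * ((1 + β) / (1 - M.discount)) /
        (m * (1 - M.discount)) ≤ κ * (1 - M.discount) / 2) {T : ℝ}
    (hT : 4 / (1 - (M.discount : ℝ)) * (Fintype.card S * Fintype.card A *
        (6 / (1 - (M.discount : ℝ)) * m + (1 + β) / (1 - (M.discount : ℝ)) * n₁) +
        (1 + β) / (1 - (M.discount : ℝ)) +
        4 * ((1 + β) / (1 - (M.discount : ℝ))) * ℓ / (1 - (M.discount : ℝ))) ≤ κ * T) :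
    μ {ω | ¬ ∃ bad : Finset ℕ, (bad.card : ℝ) ≤ T ∧ ∀ t ∉ bad,
      M.optValue (X t ω) - M.value
        (FinMDP.det (policy M greedy β m (fun i => X i ω) t)) (X t ω) ≤ 2 * κ} ≤
      ENNReal.ofReal ((Fintype.card S * Fintype.card A * m : ℝ) *
          (Real.exp (-(2 * (β * (1 - M.discount)) ^ 2)) +
            Real.exp (-(2 * (2 * β * (1 - M.discount)) ^ 2))) +
        (Fintype.card S * Fintype.card A * Fintype.card S : ℝ) * Real.exp (-ℓ) +
        Real.exp (-ℓ)) := by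
  classical
  have hγ0 := M.discount.2.1
  have hγ1 : (0 : ℝ) < 1 - M.discount := sub_pos.mpr M.discount.2.2
  set B := (1 + β) / (1 - (M.discount : ℝ)) with hB
  have hB0 : 0 < B := by positivity
  set P : ℕ → (ℕ → S) → ℝ :=
    fun t x => (memory M greedy β m x t).potential M greedy β κ (x t) with hPdef
  have hPadapt : ∀ t x y, (∀ i ≤ t, x i = y i) → P t x = P t y := fun t x y h => by
    simp only [hPdef, memory_congr M greedy β m t h, h t le_rfl]
  have hP0 : ∀ t x, 0 ≤ P t x := fun t x => Memory.potential_nonneg _ _ _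
  have hrew : ∀ t x, (memory M greedy β m x t).RewardsOf M := fun t x s a =>
    memory_rewardSum M greedy β m x t s a
  have hPB : ∀ t x, P t x ≤ B := fun t x => Memory.potential_le (hrew t x) hβ greedy hκ.le _
  have hstep : ∀ t x, stepMean M greedy β m P t x = ∑ y, M.trans (x t) (action M greedy β m x t) y *
      ((memory M greedy β m x t).update m (x t) (action M greedy β m x t)
        (M.reward (x t) (action M greedy β m x t)) y).potential M greedy β κ y := by
    intro t x
    refine Finset.sum_congr rfl fun y _ => ?_
    have hu : ∀ i ≤ t, Function.update x (t + 1) y i = x i := fun i hi =>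
      Function.update_of_ne (by omega) _ _
    simp only [hPdef, memory_succ, memory_congr M greedy β m t hu,
      action_congr M greedy β m t hu, hu t le_rfl, Function.update_self]
  set θ := (1 - (M.discount : ℝ)) / (4 * B) with hθ
  have hθB : θ * B ≤ 1 := by
    rw [hθ, div_mul_eq_mul_div, div_le_one (by positivity)]
    nlinarith
  have hev1 := hX.measure_exists_not_accurate hβ ℓ
  have hev2 := hX.measure_exists_le_sum_stepMean hPadapt hP0 hPB (by positivity) hθB ℓ
  refine (measure_mono ?_).trans ((measure_union_le _ _).trans
    ((add_le_add hev1 hev2).trans (ENNReal.ofReal_add (by positivity) (by positivity)).ge))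
  intro ω hω
  by_contra hcon
  refine hω ?_
  simp only [Set.mem_union, not_or] at hcon
  obtain ⟨hacc, hdev⟩ := hcon
  have hacc' : ∀ t, (memory M greedy β m (fun i => X i ω) t).Accurate M β ℓ := fun t => by
    by_contra h
    exact hacc ⟨t, h⟩
  set x : ℕ → S := fun i => X i ω with hx
  set z : ℕ → ℝ := fun t =>
    (if (memory M greedy β m x t).count (x t) (action M greedy β m x t) < m then
      6 / (1 - (M.discount : ℝ)) else 0) +
    (if (memory M greedy β m x t).count (x t) (action M greedy β m x t) < n₁ then B else 0)
    with hz
  have hrec : ∀ t, P t x ≤ z t + (1 - (1 - M.discount) / 2) * stepMean M greedy β m P t x := by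
    intro t
    rw [hstep]
    exact Memory.potential_le_step hg (hrew t x) (hacc' t) hβ hℓ hκ.le hn₁ hn₁m
      (memory_count_le M greedy β m x t) h1 h2 h3 rfl
  have hzsum : ∀ N, ∑ t ∈ Finset.range N, z t ≤ Fintype.card S * Fintype.card A *
        (6 / (1 - (M.discount : ℝ)) * m + B * n₁) := by
    intro N
    have hv : ∀ k ≤ m, ∀ c : ℝ, 0 ≤ c → ∑ t ∈ Finset.range N,
        (if (memory M greedy β m x t).count (x t) (action M greedy β m x t) < k then c else 0) ≤
        Fintype.card S * Fintype.card A * (c * k) := by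
      intro k hk c hc
      have h4 : ((∑ t ∈ Finset.range N, (if (memory M greedy β m x t).count (x t)
        (action M greedy β m x t) < k then 1 else 0) : ℕ) : ℝ) ≤
          (Fintype.card S * Fintype.card A * k : ℕ) :=
        Nat.cast_le.mpr (sum_range_visit_le M greedy β m x hk N)
      push_cast at h4
      calc _ = c * ∑ t ∈ Finset.range N, (if (memory M greedy β m x t).count (x t)
            (action M greedy β m x t) < k then (1 : ℝ) else 0) := by
            rw [Finset.mul_sum]
            exact Finset.sum_congr rfl fun t _ => by split_ifs <;> simp
        _ ≤ c * (Fintype.card S * Fintype.card A * k) := mul_le_mul_of_nonneg_left h4 hc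
        _ = _ := by ring
    rw [hz, Finset.sum_add_distrib]
    have h5 := hv m le_rfl (6 / (1 - M.discount)) (by positivity)
    have h6 := hv n₁ hn₁m B hB0.le
    rw [mul_add]
    exact add_le_add h5 h6
  have hE0 : ∀ t, 0 ≤ stepMean M greedy β m P t x := fun t =>
    Finset.sum_nonneg fun y _ => mul_nonneg (M.trans_nonneg _ _ _) (hP0 _ _)
  have hPsum : ∀ N, ∑ t ∈ Finset.range N, P t x ≤ κ * T := by
    intro N
    have hdevN : ∑ i ∈ Finset.range N, (θ * (1 - θ * B) * stepMean M greedy β m P i x -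
        θ * P (i + 1) x) ≤ ℓ := by
      by_contra! h
      exact hdev ⟨N, h.le⟩
    refine (sum_range_le_of_recursion hγ1 (by linarith) hB0 hℓ (fun i => hPB i x)
      (fun i => hP0 i x) hE0 hrec N hdevN).trans (le_trans ?_ hT)
    gcongr
    exact hzsum N
  -- A Markov-type count: each of these times contributes at least κ to a sum bounded by κT.
  -- Finiteness of the set of all such times follows from the same bound on its finite subsets.
  have hcard : ∀ F : Finset ℕ, (∀ t ∈ F, κ ≤ P t x) → (F.card : ℝ) ≤ T := by
    intro F hF
    obtain ⟨N, hN⟩ : ∃ N, F ⊆ Finset.range N :=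
      ⟨F.sup id + 1, fun t ht => Finset.mem_range.mpr
        (Nat.lt_succ_of_le (Finset.le_sup (f := id) ht))⟩
    have h4 : F.card * κ ≤ κ * T := by
      calc F.card * κ = ∑ t ∈ F, κ := by rw [Finset.sum_const, nsmul_eq_mul]
        _ ≤ ∑ t ∈ F, P t x := Finset.sum_le_sum hF
        _ ≤ ∑ t ∈ Finset.range N, P t x :=
            Finset.sum_le_sum_of_subset_of_nonneg hN fun t _ _ => hP0 t x
        _ ≤ _ := hPsum N
    rw [mul_comm] at h4
    exact le_of_mul_le_mul_left h4 hκ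
  have hfin : {t | κ ≤ P t x}.Finite := by
    by_contra hinf
    obtain ⟨F, hF, hFc⟩ := Set.Infinite.exists_subset_card_eq hinf (⌊T⌋₊ + 1)
    have h4 := hcard F fun t ht => hF ht
    rw [hFc] at h4
    push_cast at h4
    exact absurd (Nat.lt_floor_add_one T) (not_lt.mpr h4)
  refine ⟨hfin.toFinset, hcard _ fun t ht => by simpa using ht, fun t ht => ?_⟩
  have hlt : P t x < κ := by simpa using ht
  have h4 := Memory.optValue_le_optimisticV (hrew t x) (hacc' t).lower hβ (x t)
  have h5 : (memory M greedy β m x t).optimisticV M.discount β (x t) -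
      M.value (FinMDP.det (policy M greedy β m x t)) (x t) - κ ≤ P t x :=
    (le_max_left _ _).trans (le_max_right _ _)
  change M.optValue (x t) - M.value (FinMDP.det (policy M greedy β m x t)) (x t) ≤ 2 * κ
  linarith

end MBIEEB

/-! ### Choice of the parameters -/

section Parameters

/-- The large parameter inside the logarithm of the sample complexity. -/
def logArg (s a e x δ : ℝ) : ℝ := 2 + s * a * e / (x * δ)

/-- The real number that is rounded up to obtain the number of experiences that MBIE-EB uses for
each state-action pair. -/
def sampleSize (s a e x δ : ℝ) : ℝ := 5184 * s * e ^ 2 * Real.log (logArg s a e x δ) ^ 2 / x ^ 4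

variable {s a e x δ : ℝ} (hs : 1 ≤ s) (ha : 1 ≤ a) (he : 1 ≤ e) (hx0 : 0 < x) (hx1 : x ≤ 1)
  (hδ0 : 0 < δ) (hδ1 : δ < 1)

include hs ha he hx0 hx1 hδ0 hδ1

theorem three_le_logArg : 3 ≤ logArg s a e x δ := by
  have h1 : 1 ≤ s * a * e / (x * δ) := by
    rw [one_le_div (by positivity)]
    have h2 : 1 ≤ s * a * e := one_le_mul_of_one_le_of_one_le
      (one_le_mul_of_one_le_of_one_le hs ha) he
    nlinarith
  unfold logArg
  linarith

theorem one_le_log_logArg : 1 ≤ Real.log (logArg s a e x δ) := by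
  have h3 := three_le_logArg hs ha he hx0 hx1 hδ0 hδ1
  rw [Real.le_log_iff_exp_le (by linarith)]
  linarith [Real.exp_one_lt_d9]

/-- With y = `logArg s a e x δ`, both s and sa/δ are at most y, and 8y² ≤ y⁴ because y ≥ 3. -/
theorem log_pairs_le : Real.log (8 * s ^ 2 * a / δ) ≤ 4 * Real.log (logArg s a e x δ) := by
  have h3 := three_le_logArg hs ha he hx0 hx1 hδ0 hδ1
  rw [← Real.log_rpow (by linarith)]
  refine Real.log_le_log (by positivity) ?_
  have hy : s * a / δ ≤ logArg s a e x δ := by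
    have : s * a / δ ≤ s * a * e / (x * δ) := by
      rw [div_le_div_iff₀ hδ0 (by positivity)]
      have hxe : x ≤ e := hx1.trans he
      have := mul_le_mul_of_nonneg_left hxe (by positivity : 0 ≤ s * a * δ)
      linarith
    unfold logArg
    linarith
  have hsy : s ≤ logArg s a e x δ := by
    refine le_trans ?_ hy
    rw [le_div_iff₀ hδ0]
    nlinarith
  set y := logArg s a e x δ
  have e1 : 8 * s ^ 2 * a / δ = 8 * s * (s * a / δ) := by ring
  rw [e1, show ((4 : ℝ)) = ((4 : ℕ) : ℝ) by norm_num, Real.rpow_natCast]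
  calc 8 * s * (s * a / δ) ≤ 8 * y * y := by gcongr
    _ ≤ y ^ 4 := by
      have : 9 ≤ y ^ 2 := by nlinarith
      nlinarith [mul_nonneg (sq_nonneg y) (by linarith : 0 ≤ y ^ 2 - 8)]

theorem le_sampleSize : 5184 ≤ sampleSize s a e x δ := by
  have hΛ := one_le_log_logArg hs ha he hx0 hx1 hδ0 hδ1
  unfold sampleSize
  rw [le_div_iff₀ (by positivity)]
  have h1 : x ^ 4 ≤ 1 := pow_le_one₀ hx0.le hx1
  have h2 : 1 ≤ e ^ 2 := one_le_pow₀ he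
  have h3 : 1 ≤ Real.log (logArg s a e x δ) ^ 2 := one_le_pow₀ hΛ
  have h4 : 1 ≤ s * e ^ 2 * Real.log (logArg s a e x δ) ^ 2 :=
    one_le_mul_of_one_le_of_one_le (one_le_mul_of_one_le_of_one_le hs h2) h3
  linarith

/-- The logarithm of m in the bonus is harmless because m is polynomial in quantities bounded by
`logArg`. The exponent 18 is 7 from these factors plus 11 from 20736 ≤ 3¹¹. -/
theorem log_union_le {m : ℝ} (hm0 : 0 < m) (hm : m ≤ 2 * sampleSize s a e x δ) :
    Real.log (2 * s * a * m / δ) ≤ 18 * Real.log (logArg s a e x δ) := by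
  have h3 := three_le_logArg hs ha he hx0 hx1 hδ0 hδ1
  have hΛ := one_le_log_logArg hs ha he hx0 hx1 hδ0 hδ1
  have hΛy : Real.log (logArg s a e x δ) ≤ logArg s a e x δ :=
    Real.log_le_self (by linarith)
  unfold sampleSize at hm
  rw [← Real.log_rpow (by linarith)]
  refine Real.log_le_log (by positivity) ?_
  rw [show ((18 : ℝ)) = ((18 : ℕ) : ℝ) by norm_num, Real.rpow_natCast]
  have hy : s * a * e / (x * δ) ≤ logArg s a e x δ := by
    unfold logArg
    linarith
  set y := logArg s a e x δ
  have hxd : x * δ ≤ x := mul_le_of_le_one_right hx0.le hδ1.le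
  have hxd' : x * δ ≤ δ := mul_le_of_le_one_left hδ0.le hx1
  have hsa : 1 ≤ s * a := one_le_mul_of_one_le_of_one_le hs ha
  have h1 : s * a / δ ≤ y := by
    refine le_trans ?_ hy
    apply div_le_div₀ (by positivity) _ (by positivity) hxd'
    exact le_mul_of_one_le_right (by positivity) he
  have h2 : s / x ≤ y := by
    refine le_trans ?_ hy
    apply div_le_div₀ (by positivity) _ (by positivity) hxd
    rw [mul_assoc]
    exact le_mul_of_one_le_right (by positivity) (one_le_mul_of_one_le_of_one_le ha he)
  have h4 : e / x ≤ y := by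
    refine le_trans ?_ hy
    apply div_le_div₀ (by positivity) _ (by positivity) hxd
    exact le_mul_of_one_le_left (by positivity) hsa
  have h5 : 1 / x ≤ y := by
    refine le_trans ?_ h4
    gcongr
  calc 2 * s * a * m / δ = 2 * (s * a / δ) * m := by ring
    _ ≤ 2 * (s * a / δ) * (2 * (5184 * s * e ^ 2 * Real.log y ^ 2 / x ^ 4)) := by gcongr
    _ = 20736 * ((s * a / δ) * (s / x) * (e / x) ^ 2 * (1 / x) * Real.log y ^ 2) := by
        field_simp
        ring
    _ ≤ 20736 * (y * y * y ^ 2 * y * y ^ 2) := by gcongr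
    _ = 20736 * y ^ 7 := by ring
    _ ≤ 3 ^ 11 * y ^ 7 := by
        gcongr
        norm_num
    _ ≤ y ^ 11 * y ^ 7 := by gcongr
    _ = y ^ 18 := by ring

end Parameters

section ParameterBounds

variable {s a e x Λ β ℓ m n : ℝ} (hs : 1 ≤ s) (ha : 1 ≤ a) (he : 1 ≤ e) (hx0 : 0 < x)
  (hx1 : x ≤ 1) (hΛ : 1 ≤ Λ) (hβ0 : 0 ≤ β) (hβ : β ≤ 3 * Λ / x)

include hx0 hx1 hΛ hβ

theorem value_bound_le : (1 + β) / x ≤ 4 * Λ / x ^ 2 := by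
  have h1 : 1 ≤ Λ / x := by
    rw [one_le_div hx0]
    linarith
  rw [div_le_iff₀ hx0]
  have e1 : 4 * Λ / x ^ 2 * x = Λ / x + 3 * Λ / x := by
    field_simp
    norm_num
  linarith

-- Fixes the size of n₁: 2 + 2sℓ ≤ 10sΛ, and the other factor is at most 4Λ/x².
include hs in
theorem value_bound_mul_le (hℓ : ℓ ≤ 4 * Λ) (hβ0 : 0 ≤ β) (hn : 40 * s * Λ ^ 2 / x ^ 3 ≤ n) :
    (2 + 2 * s * ℓ) * ((1 + β) / x) ≤ n * x := by
  have h1 := value_bound_le hx0 hx1 hΛ hβ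
  have hsΛ : 1 ≤ s * Λ := one_le_mul_of_one_le_of_one_le hs hΛ
  have h2 : 2 + 2 * s * ℓ ≤ 10 * (s * Λ) := by nlinarith
  calc (2 + 2 * s * ℓ) * ((1 + β) / x) ≤ 10 * (s * Λ) * ((1 + β) / x) := by gcongr
    _ ≤ 10 * (s * Λ) * (4 * Λ / x ^ 2) := by gcongr
    _ = 40 * s * Λ ^ 2 / x ^ 3 * x := by
        field_simp
        norm_num
    _ ≤ n * x := by gcongr

-- Fixes the size of m. With κ = 1/(2e) the right-hand side κx/2 is shared equally by the two
-- errors. The first requires √m ≥ 72eΛ/x², and 5184 = 72²; the factor s in m is there for the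
-- second.
include hs he hβ0 in
theorem model_error_le (hℓ : ℓ ≤ 4 * Λ)
    (hm : 5184 * s * e ^ 2 * Λ ^ 2 / x ^ 4 ≤ m) :
    3 * β / √m + 2 * s * ℓ * ((1 + β) / x) / (m * x) ≤ 1 / (2 * e) * x / 2 := by
  have h1 := value_bound_le hx0 hx1 hΛ hβ
  have hsq : 72 * e * Λ / x ^ 2 ≤ √m := by
    refine Real.le_sqrt_of_sq_le (le_trans ?_ hm)
    have e1 : (72 * e * Λ / x ^ 2) ^ 2 = 5184 * 1 * e ^ 2 * Λ ^ 2 / x ^ 4 := by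
      field_simp
      norm_num
    rw [e1]
    gcongr
  have h2 : 3 * β / √m ≤ x / (8 * e) := by
    calc 3 * β / √m ≤ 3 * (3 * Λ / x) / (72 * e * Λ / x ^ 2) := by gcongr
      _ = x / (8 * e) := by
        field_simp
        norm_num
  have h3 : 2 * s * ℓ * ((1 + β) / x) / (m * x) ≤ x / (8 * e) := by
    calc 2 * s * ℓ * ((1 + β) / x) / (m * x)
        ≤ 2 * s * (4 * Λ) * (4 * Λ / x ^ 2) / (5184 * s * e ^ 2 * Λ ^ 2 / x ^ 4 * x) := by
          gcongr
      _ = x / (162 * e ^ 2) := by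
        field_simp
        norm_num
      _ ≤ x / (8 * e) := by
        gcongr
        · norm_num
        · nlinarith
  have e2 : 1 / (2 * e) * x / 2 = x / (8 * e) + x / (8 * e) := by
    field_simp
    norm_num
  linarith

-- All terms are compared with one monomial `G`; the visits up to m dominate. The numerical factors
-- add up to less than 75000.
include hs ha he in
theorem total_cost_le (hℓ0 : 0 ≤ ℓ) (hℓ : ℓ ≤ 4 * Λ)
    (hm : m ≤ 10368 * s * e ^ 2 * Λ ^ 2 / x ^ 4) (hn0 : 0 ≤ n)
    (hn : n ≤ 80 * s * Λ ^ 2 / x ^ 3) :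
    4 / x * (s * a * (6 / x * m + (1 + β) / x * n) + (1 + β) / x + 4 * ((1 + β) / x) * ℓ / x) ≤
      1 / (2 * e) * (600000 * (s ^ 2 * a * e ^ 3 / x ^ 6) * Λ ^ 3) := by
  have h1 := value_bound_le hx0 hx1 hΛ hβ
  set G := s ^ 2 * a * e ^ 2 * Λ ^ 3 / x ^ 5 with hG
  have hG0 : 0 ≤ G := by positivity
  have hs2 : 1 ≤ s ^ 2 := one_le_pow₀ hs
  have he2 : 1 ≤ e ^ 2 := one_le_pow₀ he
  have hΛ2 : 1 ≤ Λ ^ 2 := one_le_pow₀ hΛ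
  have hsa : 1 ≤ s ^ 2 * a := one_le_mul_of_one_le_of_one_le hs2 ha
  have hsae : 1 ≤ s ^ 2 * a * e ^ 2 := one_le_mul_of_one_le_of_one_le hsa he2
  have hx2 : x ^ 2 ≤ 1 := pow_le_one₀ hx0.le hx1
  have hx3 : x ^ 3 ≤ 1 := pow_le_one₀ hx0.le hx1
  have t1 : s * a * (6 / x * m) ≤ 62208 * G := by
    calc s * a * (6 / x * m) ≤ s * a * (6 / x * (10368 * s * e ^ 2 * Λ ^ 2 / x ^ 4)) := by gcongr
      _ = 62208 * (s ^ 2 * a * e ^ 2 * Λ ^ 2 * 1 / x ^ 5) := by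
        field_simp
        norm_num
      _ ≤ 62208 * (s ^ 2 * a * e ^ 2 * Λ ^ 2 * Λ / x ^ 5) := by gcongr
      _ = _ := by rw [hG]; ring
  have t2 : s * a * ((1 + β) / x * n) ≤ 320 * G := by
    calc s * a * ((1 + β) / x * n) ≤ s * a * (4 * Λ / x ^ 2 * (80 * s * Λ ^ 2 / x ^ 3)) := by
          gcongr
      _ = 320 * (s ^ 2 * a * 1 * Λ ^ 3 / x ^ 5) := by
        field_simp
        norm_num
      _ ≤ 320 * (s ^ 2 * a * e ^ 2 * Λ ^ 3 / x ^ 5) := by gcongr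
  have t3 : (1 + β) / x ≤ 4 * G := by
    refine h1.trans ?_
    rw [hG, div_le_iff₀ (by positivity)]
    have e1 : 4 * (s ^ 2 * a * e ^ 2 * Λ ^ 3 / x ^ 5) * x ^ 2 =
        4 * Λ * (s ^ 2 * a * e ^ 2 * Λ ^ 2 / x ^ 3) := by
      field_simp
    rw [e1]
    refine le_mul_of_one_le_right (by positivity) ?_
    rw [one_le_div (by positivity)]
    exact hx3.trans (one_le_mul_of_one_le_of_one_le hsae hΛ2)
  have t4 : 4 * ((1 + β) / x) * ℓ / x ≤ 64 * G := by
    calc 4 * ((1 + β) / x) * ℓ / x ≤ 4 * (4 * Λ / x ^ 2) * (4 * Λ) / x := by gcongr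
      _ = 64 * (1 * Λ ^ 2 * 1 / x ^ 3) := by
        field_simp
        norm_num
      _ ≤ 64 * (s ^ 2 * a * e ^ 2 * Λ ^ 2 * (Λ / x ^ 2) / x ^ 3) := by
        have : 1 ≤ Λ / x ^ 2 := by
          rw [one_le_div (by positivity)]
          linarith
        gcongr
      _ = 64 * G := by
        rw [hG]
        field_simp
  calc _ ≤ 4 / x * (75000 * G) := by
        gcongr
        rw [mul_add]
        linarith
    _ = _ := by
        rw [hG]
        field_simp
        norm_num

end ParameterBounds

/-- The failure probabilities of the analysis sum up to at most `δ`. -/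
theorem failure_probability_le {s a m δ : ℝ} (hs : 1 ≤ s) (ha : 1 ≤ a) (hm : 1 ≤ m) (hδ0 : 0 < δ)
    (hδ1 : δ < 1) {q : ℝ} (hq : q = Real.log (2 * s * a * m / δ)) :
    (s * a * m) * (Real.exp (-q) + Real.exp (-(4 * q))) +
      (s * a * s) * Real.exp (-Real.log (8 * s ^ 2 * a / δ)) +
        Real.exp (-Real.log (8 * s ^ 2 * a / δ)) ≤ δ := by
  have hsa : 1 ≤ s * a := one_le_mul_of_one_le_of_one_le hs ha
  have hsam : 1 ≤ s * a * m := one_le_mul_of_one_le_of_one_le hsa hm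
  have h1 : Real.exp (-q) = δ / (2 * s * a * m) := by
    rw [hq, Real.exp_neg, Real.exp_log (by positivity), inv_div]
  have h2 : Real.exp (-Real.log (8 * s ^ 2 * a / δ)) = δ / (8 * s ^ 2 * a) := by
    rw [Real.exp_neg, Real.exp_log (by positivity), inv_div]
  have hp : δ / (2 * s * a * m) ≤ 1 / 2 := by
    rw [div_le_div_iff₀ (by positivity) (by norm_num)]
    nlinarith
  -- The prescribed β makes lower deviations cost δ/2. Upper deviations are allowed 2β and so cost
  -- at most δ/16, which leaves room for δ/8 from the transition counts and at most δ/8 from the sum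
  -- of conditional means.
  have h3 : Real.exp (-(4 * q)) ≤ δ / (2 * s * a * m) * (1 / 2) ^ 3 := by
    have e : Real.exp (-(4 * q)) = Real.exp (-q) * Real.exp (-q) ^ 3 := by
      rw [← Real.exp_nat_mul, ← Real.exp_add]
      congr 1
      push_cast
      ring
    rw [e, h1]
    gcongr
  rw [h1, h2]
  have e1 : s * a * m * (δ / (2 * s * a * m)) = δ / 2 := by
    field_simp
  have e2 : s * a * s * (δ / (8 * s ^ 2 * a)) = δ / 8 := by
    field_simp
  have h4 : δ / (8 * s ^ 2 * a) ≤ δ / 8 := by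
    have : 1 ≤ s ^ 2 * a := one_le_mul_of_one_le_of_one_le (one_le_pow₀ hs) ha
    gcongr
    linarith
  have h5 := mul_le_mul_of_nonneg_left h3 (by positivity : 0 ≤ s * a * m)
  rw [← mul_assoc, e1] at h5
  rw [mul_add, e1, e2]
  linarith

/-! ### The PAC bound for the algorithm -/

namespace MBIEEB

/-- The number of experiences of each state-action pair that MBIE-EB uses. -/
def experiences (nS nA : ℕ) (ε δ γ : ℝ) : ℕ := ⌈sampleSize nS nA (max 1 (1 / ε)) (1 - γ) δ⌉₊

open MeasureTheory

/-- The PAC bound for MBIE-EB. -/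
theorem IsRun.measure_not_pac {S A : Type*} [Fintype S] [Fintype A] [Nonempty S] [Nonempty A]
    {M : FinMDP S A} {greedy : (S → A → ℝ) → S → A} (hg : IsGreedyRule greedy) {ε δ β : ℝ}
    {m : ℕ} (hε : 0 < ε) (hδ0 : 0 < δ) (hδ1 : δ < 1)
    (hm : m = experiences (Fintype.card S) (Fintype.card A) ε δ M.discount)
    (hβ : β = bonus (Fintype.card S) (Fintype.card A) m δ M.discount)
    {Ω : Type*} [MeasurableSpace Ω] {μ : Measure Ω} [IsProbabilityMeasure μ] {X : ℕ → Ω → S}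
    (hX : IsRun M greedy β m μ X) :
    μ {ω | ¬ ∃ bad : Finset ℕ, (bad.card : ℝ) ≤
        softBound 600000 3 (Fintype.card S) (Fintype.card A) ε δ M.discount ∧ ∀ t ∉ bad,
      M.optValue (X t ω) - M.value
        (FinMDP.det (policy M greedy β m (fun i => X i ω) t)) (X t ω) ≤ ε} ≤
      ENNReal.ofReal δ := by
  have hγ0 := M.discount.2.1
  have hx0 : (0 : ℝ) < 1 - M.discount := sub_pos.mpr M.discount.2.2
  have hx1 : (1 : ℝ) - M.discount ≤ 1 := by linarith
  have hs : (1 : ℝ) ≤ Fintype.card S := by exact_mod_cast Fintype.card_pos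
  have ha : (1 : ℝ) ≤ Fintype.card A := by exact_mod_cast Fintype.card_pos
  set s : ℝ := (Fintype.card S : ℝ) with hsdef
  set a : ℝ := (Fintype.card A : ℝ) with hadef
  set e : ℝ := max 1 (1 / ε) with hedef
  have he : 1 ≤ e := le_max_left _ _
  set x : ℝ := 1 - (M.discount : ℝ) with hxdef
  set Λ : ℝ := Real.log (logArg s a e x δ) with hΛdef
  have hΛ : 1 ≤ Λ := one_le_log_logArg hs ha he hx0 hx1 hδ0 hδ1
  set ℓ : ℝ := Real.log (8 * s ^ 2 * a / δ) with hℓdef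
  have hℓ : ℓ ≤ 4 * Λ := log_pairs_le hs ha he hx0 hx1 hδ0 hδ1
  have hℓ0 : 0 ≤ ℓ := by
    refine Real.log_nonneg ?_
    rw [one_le_div hδ0]
    have : 1 ≤ s ^ 2 * a := one_le_mul_of_one_le_of_one_le (one_le_pow₀ hs) ha
    linarith
  have hsize := le_sampleSize hs ha he hx0 hx1 hδ0 hδ1
  have hm_ge : sampleSize s a e x δ ≤ m := by
    rw [hm]
    exact Nat.le_ceil _
  have hm_le : (m : ℝ) ≤ 2 * sampleSize s a e x δ := by
    rw [hm]
    exact Nat.ceil_le_two_mul (by linarith)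
  have hm_le' : (m : ℝ) ≤ 10368 * s * e ^ 2 * Λ ^ 2 / x ^ 4 := by
    refine hm_le.trans (le_of_eq ?_)
    rw [sampleSize, ← hΛdef]
    ring
  have hm1 : (1 : ℝ) ≤ m := by linarith
  set q : ℝ := Real.log (2 * s * a * m / δ) with hqdef
  have hq : q ≤ 18 * Λ := log_union_le hs ha he hx0 hx1 hδ0 hδ1 (by linarith) hm_le
  have hq0 : 0 ≤ q := by
    refine Real.log_nonneg ?_
    rw [one_le_div hδ0]
    have : 1 ≤ s * a * m :=
      one_le_mul_of_one_le_of_one_le (one_le_mul_of_one_le_of_one_le hs ha) hm1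
    linarith
  have hβe : β = 1 / x * √(q / 2) := hβ
  have hβ0 : 0 ≤ β := by
    rw [hβe]
    positivity
  have hβx : (β * x) ^ 2 = q / 2 := by
    rw [hβe, mul_right_comm, one_div_mul_cancel hx0.ne', one_mul, Real.sq_sqrt (by positivity)]
  have hβ3 : β ≤ 3 * Λ / x := by
    rw [le_div_iff₀ hx0]
    refine abs_le_of_sq_le_sq' ?_ (by positivity) |>.2
    rw [hβx]
    nlinarith
  have hN0 : 1 ≤ 40 * s * Λ ^ 2 / x ^ 3 := by
    rw [one_le_div (by positivity)]
    have h1 : x ^ 3 ≤ 1 := pow_le_one₀ hx0.le hx1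
    have h2 : 1 ≤ s * Λ ^ 2 := one_le_mul_of_one_le_of_one_le hs (one_le_pow₀ hΛ)
    linarith
  have hn_ge : 40 * s * Λ ^ 2 / x ^ 3 ≤ ⌈40 * s * Λ ^ 2 / x ^ 3⌉₊ := Nat.le_ceil _
  have hn_le : (⌈40 * s * Λ ^ 2 / x ^ 3⌉₊ : ℝ) ≤ 80 * s * Λ ^ 2 / x ^ 3 := by
    refine (Nat.ceil_le_two_mul (by linarith)).trans (le_of_eq ?_)
    ring
  have hnm : ⌈40 * s * Λ ^ 2 / x ^ 3⌉₊ ≤ m := by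
    rw [hm]
    refine Nat.ceil_mono ?_
    change _ ≤ 5184 * s * e ^ 2 * Λ ^ 2 / x ^ 4
    have h1 : 1 ≤ e ^ 2 := one_le_pow₀ he
    have h2 : x ^ 4 ≤ x ^ 3 := pow_le_pow_of_le_one hx0.le hx1 (by norm_num)
    calc 40 * s * Λ ^ 2 / x ^ 3 ≤ 5184 * s * Λ ^ 2 / x ^ 4 := by
          gcongr
          norm_num
      _ = 5184 * s * 1 * Λ ^ 2 / x ^ 4 := by rw [mul_one]
      _ ≤ 5184 * s * e ^ 2 * Λ ^ 2 / x ^ 4 := by gcongr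
  -- This κ gives 2κ = 1/e = min(1, ε), which also covers ε > 1.
  have hmain := hX.measure_not_forall_near_optimal hg hβ0 hℓ0 (κ := 1 / (2 * e)) (by positivity)
    (n₁ := ⌈40 * s * Λ ^ 2 / x ^ 3⌉₊) (Nat.ceil_pos.mpr (by linarith)) hnm
    (by
      refine le_trans ?_ hn_ge
      rw [le_div_iff₀ (by positivity)]
      have e1 : β ^ 2 * x ^ 3 = (β * x) ^ 2 * x := by ring
      rw [e1, hβx]
      have h1 : Λ ≤ Λ ^ 2 := by nlinarith
      have h2 : Λ ^ 2 ≤ s * Λ ^ 2 := le_mul_of_one_le_left (by positivity) hs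
      nlinarith)
    (value_bound_mul_le hs hx0 hx1 hΛ hβ3 hℓ hβ0 hn_ge)
    (model_error_le hs he hx0 hx1 hΛ hβ0 hβ3 hℓ hm_ge)
    (T := softBound 600000 3 (Fintype.card S) (Fintype.card A) ε δ M.discount)
    (total_cost_le hs ha he hx0 hx1 hΛ hβ3 hℓ0 hℓ
      hm_le' (Nat.cast_nonneg _) hn_le)
  have h2κ : 2 * (1 / (2 * e)) ≤ ε := by
    have h1 : 1 / ε ≤ e := le_max_right _ _
    rw [div_le_iff₀ hε] at h1
    rw [mul_one_div, div_le_iff₀ (by positivity)]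
    linarith
  refine (measure_mono ?_).trans (hmain.trans (ENNReal.ofReal_le_ofReal ?_))
  · rintro ω hω ⟨bad, h1, h2⟩
    exact hω ⟨bad, h1, fun t ht => (h2 t ht).trans h2κ⟩
  · have e1 : 2 * (β * x) ^ 2 = q := by
      rw [hβx]
      ring
    have e2 : 2 * (2 * β * x) ^ 2 = 4 * q := by
      rw [← e1]
      ring
    rw [e1, e2]
    exact failure_probability_le hs ha hm1 hδ0 hδ1 rfl

end MBIEEB

end

/-! ### Transfer to the ground MDP -/

theorem proposition2 :
    ∃ (C : ℝ) (k : ℕ) (m : ℕ → ℕ → ℝ → ℝ → ℝ → ℕ),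
      ∀ (SG SA A : Type*) [Fintype SG] [Fintype SA] [Fintype A] [Nonempty SG] [Nonempty A]
        (MG : FinMDP SG A)
        -- the aggregation function, whose image is the abstract state space, and the weights
        (φ : SG → SA) (hφ : Function.Surjective φ) (w : SG → ℝ) (hw : IsWeighting φ w)
        -- an approximate abstraction with sub-optimality bounded by `g η`
        (η : ℝ) (_ : 0 < η) (f : SG → A → ℝ) (_ : IsApproxAbstraction φ f η)
        (g : ℝ → ℝ) (_ : SuboptBounded MG (abstractMDP MG φ hφ w hw) φ g η) (_ : 0 < g η)
        (δ : ℝ) (_ : 0 < δ) (_ : δ < 1)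
        (greedy : (SA → A → ℝ) → SA → A) (_ : IsGreedyRule greedy)
        (β : ℝ) (M : ℕ)
        -- the constants of the algorithm, for the accuracy `g η`
        (_ : M = m (Fintype.card SA) (Fintype.card A) (g η) δ MG.discount)
        (_ : β = MBIEEB.bonus (Fintype.card SA) (Fintype.card A) M δ MG.discount)
        -- a run of MBIE-EB in the abstract MDP
        (Ω : Type*) [MeasurableSpace Ω] (μ : MeasureTheory.Measure Ω)
        [MeasureTheory.IsProbabilityMeasure μ] (X : ℕ → Ω → SA)
        (_ : MBIEEB.IsRun (abstractMDP MG φ hφ w hw) greedy β M μ X),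
        0 < M ∧
        ENNReal.ofReal (1 - δ) ≤
          μ {ω | ∃ bad : Finset ℕ,
            (bad.card : ℝ) ≤
              softBound C k (Fintype.card SA) (Fintype.card A) (g η) δ MG.discount ∧
            ∀ t ∉ bad, ∀ s : SG, φ s = X t ω →
              MG.optValue s
                - MG.value (FinMDP.det fun s' =>
                    MBIEEB.policy (abstractMDP MG φ hφ w hw) greedy β M
                      (fun i => X i ω) t (φ s')) s
                ≤ 3 * g η} := by
  refine ⟨600000, 3, MBIEEB.experiences, ?_⟩
  intro SG SA A _ _ _ _ _ MG φ hφ w hw η _ f _ g hsub hg δ hδ0 hδ1 greedy hgr β M hM hβ Ω _ μ _ X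
    hX
  have : Nonempty SA := Nonempty.map φ inferInstance
  have hx0 : (0 : ℝ) < 1 - MG.discount := sub_pos.mpr MG.discount.2.2
  have hs : (1 : ℝ) ≤ Fintype.card SA := by exact_mod_cast Fintype.card_pos
  have ha : (1 : ℝ) ≤ Fintype.card A := by exact_mod_cast Fintype.card_pos
  refine ⟨?_, ?_⟩
  · have hsize := le_sampleSize hs ha (le_max_left 1 (1 / g η)) hx0
      (sub_le_self _ MG.discount.2.1) hδ0 hδ1
    rw [hM, MBIEEB.experiences]
    exact Nat.ceil_pos.mpr (by linarith)
  · have hdisc : (abstractMDP MG φ hφ w hw).discount = MG.discount := rfl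
    rw [← hdisc] at hM hβ
    have hbad := hX.measure_not_pac hgr hg hδ0 hδ1 hM hβ
    rw [hdisc] at hbad
    rw [ENNReal.ofReal_sub _ hδ0.le, ENNReal.ofReal_one, tsub_le_iff_right]
    refine le_trans ?_ (add_le_add_right hbad _)
    -- Subadditivity of the outer measure suffices, so neither event has to be shown measurable.
    refine le_trans (le_of_eq (MeasureTheory.measure_univ (μ := μ)).symm) (le_trans
      (MeasureTheory.measure_mono fun ω _ => ?_) (MeasureTheory.measure_union_le _ _))
    rw [Set.mem_union, or_iff_not_imp_right]
    intro hω
    obtain ⟨bad, hcard, hopt⟩ := not_not.mp hω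
    refine ⟨bad, hcard, fun t ht s hst => ?_⟩
    -- Three errors of size `g η`: the loss in the abstract MDP (`h1`), the optimal values (`h2`)
    -- and the lifted policy (`h3`).
    have h1 := hopt t ht
    rw [← hst] at h1
    have h2 := abs_le.mp (hsub.opt s)
    have h3 := abs_le.mp (hsub.policy (FinMDP.det (MBIEEB.policy (abstractMDP MG φ hφ w hw) greedy
      β M (fun i => X i ω) t)) (fun sb => by
        classical
        refine ⟨fun a => ?_, ?_⟩
        · simp only [FinMDP.det]
          split_ifs <;> norm_num
        · simp [FinMDP.det]) s)
    change MG.optValue s - MG.value (fun s' => FinMDP.det (MBIEEB.policy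
      (abstractMDP MG φ hφ w hw) greedy β M (fun i => X i ω) t) (φ s')) s ≤ 3 * g η
    linarith [h2.1, h2.2, h3.1, h3.2]
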